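/- Let $f_1,f_2\in\mathbb C[x_1,x_2,x_3]$ (for instance with real coefficients) define an irreducible algebraic curve $\mathcal C=\{f_1=f_2=0\}\subset\mathbb C^3$ whose projective closure has only points at infinity $(x_1:x_2:x_3:0)$ with $x_1\neq 0$. Let $\mathcal C_p=\{f^p=0\}\subset\mathbb C^2$, $f^p\ne 0$, be the Zariski closure of the projection of $\mathcal C$ along the $x_3$-axis, and let $h=h_1/h_2$ be a lift function: $h_1,h_2\in\mathbb C[x_1,x_2]$, $h_2$ does not vanish identically on $\mathcal C_p$, and, wherever $h_2(x_1,x_2)\neq0$, one has $(x_1,x_2,x_3)\in\mathcal C$ if and only if $(x_1,x_2)\in\mathcal C_p$ and $x_3=h(x_1,x_2)$. Let $F_3(x_1,x_2,x_3,x_4)$ be the homogenization of $f_3=x_3h_2(x_1,x_2)-h_1(x_1,x_2)$. Let $B_p=\{(z,r_2(z)):|z|>M\}\subset\mathcal C_p$, $M>0$, be an infinity branch of $\mathcal C_p$, where $r_2(z)=\sum_{i\ge0}a_iz^{1-i/k}$ ($k\ge1$) converges for $|z|>M$. For undetermined coefficients $b_0,b_1,\dots$ and integers $0\le m\le n$,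 write $$F_3\Big(t^{n+k},\ \sum_{i=0}^{n+k}a_it^{n+k-i},\ t^{n-m}\sum_{i=0}^{m+k}b_it^{m+k-i},\ t^n\Big)=\sum_{j=0}^{\mu}\Lambda_j\,t^{\mu-j},$$ where $\mu$ is the degree in $t$; $\mu$ and the polynomials $\Lambda_j$ in $b_0,\dots,b_{m+k}$ depend on $n$, $m$ and the $a_i$. Say that the leading term is determined by $a_0,\dots,a_r$ if, for $m=0$ and all sufficiently large $n$, neither $\mu$ nor $\Lambda_0$ changes when the $a_i$ with $i>r$ are replaced by arbitrary complex numbers. Then there is a unique corresponding infinity branch $B=\{(z,r_2(z),r_3(z)):|z|>M\}\subset\mathcal C$ with $$r_3(z^k)=b_0z^k+b_1z^{k-1}+\cdots+b_k+\frac{b_{k+1}}{z}+\cdots+\frac{b_{k+m}}{z^m}+\cdots\qquad(|z^k|>M),$$ and its coefficients are determined as follows. Some $r$ exists such that the leading term is determined by $a_0,\dots,a_r$. For every such $r$: 1. for every $m\ge0$, all sufficiently large $n$ satisfy $r+m\le n$ and $\mu-m-k\ge0$; 2. there are polynomials $\rho=\rho(a_0,\dots,a_r)$ and $\rho_j=\rho_j(a_0,\dots,a_{r+j},b_0,\dots,b_{j-1})$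 ($j\ge0$), independent of $m$ and $n$, with $\rho(a_0,\dots,a_r)\neq0$, such that for all $m,n\ge0$ with $r+m\le n$ and $\mu-m-k\ge0$ $$\Lambda_j=b_j\,\rho(a_0,\dots,a_r)-\rho_j(a_0,\dots,a_{r+j},b_0,\dots,b_{j-1}),\qquad j=0,\dots,m+k,$$ and this, with the same $\mu$, $\rho$ and $\rho_j$, remains true if the $a_i$ with $i>r$ are replaced by arbitrary complex numbers; 3. for all such $m,n$, the triangular linear system $\Lambda_0=\Lambda_1=\cdots=\Lambda_{m+k}=0$ has exactly one solution $(b_0,\dots,b_{m+k})$, namely the first $m+k+1$ coefficients of $r_3$. -/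

import Mathlib

open MvPolynomial in
/-- The affine algebraic set `{f₁ = f₂ = 0}` in `ℂ³`. -/
def spaceCurve (f₁ f₂ : MvPolynomial (Fin 3) ℂ) : Set (Fin 3 → ℂ) :=
  {x | eval x f₁ = 0 ∧ eval x f₂ = 0}

/-- The affine algebraic set `{g = 0}` in `ℂ²`. -/
def planeCurve (g : MvPolynomial (Fin 2) ℂ) : Set (Fin 2 → ℂ) :=
  {x | MvPolynomial.eval x g = 0}

/-- The Zariski closure of a subset of affine space. -/
def zariskiClosure {d : ℕ} (S : Set (Fin d → ℂ)) : Set (Fin d → ℂ) :=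
  MvPolynomial.zeroLocus ℂ (MvPolynomial.vanishingIdeal ℂ S)

/-- The algebraic set `S` is irreducible of dimension one: its coordinate ring is an integral
domain of Krull dimension one. -/
def IsIrreducibleCurve {d : ℕ} (S : Set (Fin d → ℂ)) : Prop :=
  (MvPolynomial.vanishingIdeal ℂ S).IsPrime ∧
    ringKrullDim (MvPolynomial (Fin d) ℂ ⧸ MvPolynomial.vanishingIdeal ℂ S) = 1

open MvPolynomial in
/-- Homogenization `x_{d+1} ^ (deg f) * f (x₁ / x_{d+1}, …, x_d / x_{d+1})`; the homogenizing
variable is the last one. -/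
noncomputable def homogenization {d : ℕ} (f : MvPolynomial (Fin d) ℂ) :
    MvPolynomial (Fin (d + 1)) ℂ :=
  ∑ e ∈ f.support, C (coeff e f) * (∏ i : Fin d, X i.castSucc ^ e i) *
    X (Fin.last d) ^ (f.totalDegree - ∑ i : Fin d, e i)

/-- `(x₁ : … : x_d : 0)` is a point of the projective closure of `S`, that is, it is annihilated by
the homogenizations of all polynomials vanishing on `S`. -/
def IsPointAtInfinity {d : ℕ} (S : Set (Fin d → ℂ)) (x : Fin d → ℂ) : Prop :=
  x ≠ 0 ∧ ∀ f ∈ MvPolynomial.vanishingIdeal ℂ S,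
    MvPolynomial.eval (Fin.snoc (α := fun _ => ℂ) x 0) (homogenization f) = 0

/-- Projection `ℂ³ → ℂ²` along the `x₃`-axis. -/
def projectAlongThird (x : Fin 3 → ℂ) : Fin 2 → ℂ := ![x 0, x 1]

/-- `h₁ / h₂` is a lift function from the plane curve `Cp` to the space curve `S`: the denominator
does not vanish identically on `Cp`, and, wherever it is nonzero, the points of `S` are the points
`(x₁, x₂, h₁(x₁, x₂) / h₂(x₁, x₂))` with `(x₁, x₂)` on `Cp`. -/
def IsLiftFunction (S : Set (Fin 3 → ℂ)) (Cp : Set (Fin 2 → ℂ))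
    (h₁ h₂ : MvPolynomial (Fin 2) ℂ) : Prop :=
  (∃ p ∈ Cp, MvPolynomial.eval p h₂ ≠ 0) ∧
    ∀ x₁ x₂ x₃ : ℂ, MvPolynomial.eval ![x₁, x₂] h₂ ≠ 0 →
      (![x₁, x₂, x₃] ∈ S ↔
        ![x₁, x₂] ∈ Cp ∧ x₃ = MvPolynomial.eval ![x₁, x₂] h₁ / MvPolynomial.eval ![x₁, x₂] h₂)

/-- `f₃(x₁, x₂, x₃) = x₃ h₂(x₁, x₂) - h₁(x₁, x₂)`. -/
noncomputable def liftPolynomial (h₁ h₂ : MvPolynomial (Fin 2) ℂ) : MvPolynomial (Fin 3) ℂ :=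
  MvPolynomial.X 2 * MvPolynomial.rename Fin.castSucc h₂ - MvPolynomial.rename Fin.castSucc h₁

/-- The terms of the Puiseux series `r(z) = a₀ z + a₁ z ^ ((k-1)/k) + a₂ z ^ ((k-2)/k) + ⋯` at
`z = w ^ k`, namely `aᵢ w ^ (k - i)`. -/
noncomputable def branchTerm (k : ℕ) (a : ℕ → ℂ) (w : ℂ) (i : ℕ) : ℂ :=
  a i * w ^ ((k : ℤ) - (i : ℤ))

/-- The value `r(w ^ k) = a₀ w ^ k + a₁ w ^ (k-1) + ⋯ + a_k + a_{k+1} w⁻¹ + ⋯`. -/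
noncomputable def branchValue (k : ℕ) (a : ℕ → ℂ) (w : ℂ) : ℂ :=
  ∑' i : ℕ, branchTerm k a w i

/-- The series `r₂` with coefficients `a` (in descending powers of `z ^ (1/k)`) converges for
`|z| > M`, and `{(z, r₂(z)) : |z| > M}` is contained in the plane curve `Cp`.  The points of the
branch are parametrized by `z = w ^ k`. -/
structure IsPlaneInfinityBranch (Cp : Set (Fin 2 → ℂ)) (k : ℕ) (a : ℕ → ℂ) (M : ℝ) : Prop where
  ramification_pos : 0 < k
  radius_pos : 0 < M
  summable : ∀ w : ℂ, M < ‖w ^ k‖ → Summable (branchTerm k a w)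
  subset : {p | ∃ w : ℂ, M < ‖w ^ k‖ ∧ p = ![w ^ k, branchValue k a w]} ⊆ Cp

/-- The series `r₂`, `r₃` with coefficients `a`, `b` (in descending powers of `z ^ (1/k)`) converge
for `|z| > M`, and `{(z, r₂(z), r₃(z)) : |z| > M}` is contained in the space curve `S`. -/
structure IsSpaceInfinityBranch (S : Set (Fin 3 → ℂ)) (k : ℕ) (a b : ℕ → ℂ) (M : ℝ) : Prop where
  ramification_pos : 0 < k
  radius_pos : 0 < M
  summable₂ : ∀ w : ℂ, M < ‖w ^ k‖ → Summable (branchTerm k a w)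
  summable₃ : ∀ w : ℂ, M < ‖w ^ k‖ → Summable (branchTerm k b w)
  subset : {p | ∃ w : ℂ, M < ‖w ^ k‖ ∧ p = ![w ^ k, branchValue k a w, branchValue k b w]} ⊆ S

/-- With `F₃` the homogenization of `f₃` and undetermined coefficients `b₀, b₁, …` (the variables of
the coefficient ring), the polynomial in `t`
`F₃(t^(n+k), a₀ t^(n+k) + ⋯ + a_{n+k}, t^(n-m) (b₀ t^(k+m) + ⋯ + b_{k+m}), t^n)`;
it is used for `m ≤ n` only. -/
noncomputable def truncatedSubstitution (f₃ : MvPolynomial (Fin 3) ℂ) (k : ℕ) (a : ℕ → ℂ)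
    (n m : ℕ) : Polynomial (MvPolynomial ℕ ℂ) :=
  MvPolynomial.aeval
    ![Polynomial.X ^ (n + k),
      ∑ i ∈ Finset.range (n + k + 1),
        Polynomial.C (MvPolynomial.C (a i)) * Polynomial.X ^ (n + k - i),
      Polynomial.X ^ (n - m) * ∑ i ∈ Finset.range (m + k + 1),
        Polynomial.C (MvPolynomial.X i) * Polynomial.X ^ (m + k - i),
      Polynomial.X ^ n]
    (homogenization f₃)

/-- The degree `μ` in `t` of the expansion above. -/
noncomputable def expansionDegree (f₃ : MvPolynomial (Fin 3) ℂ) (k : ℕ) (a : ℕ → ℂ)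
    (n m : ℕ) : ℕ :=
  (truncatedSubstitution f₃ k a n m).natDegree

/-- The coefficient `Λ_j` of `t ^ (μ - j)` in the expansion above, a polynomial in `b₀, b₁, …`. -/
noncomputable def expansionCoeff (f₃ : MvPolynomial (Fin 3) ℂ) (k : ℕ) (a : ℕ → ℂ)
    (n m j : ℕ) : MvPolynomial ℕ ℂ :=
  (truncatedSubstitution f₃ k a n m).coeff (expansionDegree f₃ k a n m - j)

/-- Of the coefficients `aᵢ`, only `a₀, …, a_r` enter the leading term `Λ₀ t ^ μ` of the expansion
(with `m = 0` and `n` large): changing the `aᵢ` with `i > r` changes neither `μ` nor `Λ₀`. -/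
def LeadingTermDeterminedUpTo (f₃ : MvPolynomial (Fin 3) ℂ) (k : ℕ) (a : ℕ → ℂ) (r : ℕ) : Prop :=
  ∀ᶠ n in Filter.atTop, ∀ a' : ℕ → ℂ, (∀ i ≤ r, a' i = a i) →
    expansionDegree f₃ k a' n 0 = expansionDegree f₃ k a n 0 ∧
      expansionCoeff f₃ k a' n 0 0 = expansionCoeff f₃ k a n 0 0

/-! Put `u = 1/t`. Along the plane branch set `α(u) = ∑ aᵢ uⁱ`, and let `P` and `Q` be the
homogenizations of `h₂` (in degree `D - 1`) and `h₁` (in degree `D`, the total degree of `f₃`) at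
`(1, α, uᵏ)`. By homogeneity, a lift `r₃` with series `β(u) = ∑ bᵢ uⁱ` satisfies `β P = Q`.

Existence and uniqueness: `P ≠ 0` because `h₂` cannot vanish along the whole branch of an
irreducible plane curve (`branchEval_mk_ne_zero`). The condition at infinity gives `‖p‖ ≤ K (1 +
‖p₀‖)` on the space curve (`exists_norm_le_of_isPointAtInfinity`), so `Q / P` is bounded and extends
holomorphically to the whole disk; its Taylor coefficients are the `bᵢ`. Cancelling `P` in `ℂ⟦u⟧`
gives uniqueness.

Coefficients: the substituted polynomial is `t ^ (D (n+k))` times `β P - Q`, with `β` symbolic and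
`α` truncated (`truncatedSubstitution_eq_reflect`). If `d` is the order of `P`, then `u ^ d` also
divides `Q`, so `μ = D (n+k) - d` and `Λ_j = ∑_{i ≤ j} bᵢ P_{d+j-i} - Q_{d+j}`. This is triangular
with pivot `ρ = P_d ≠ 0`.

It remains to see which `aᵢ` enter. If changes of `α` from order `r + 1` on move no coefficient of
`P` and `Q` up to order `d`, then changes from order `r + 1 + j` on move none up to order `d + j`
(`X_pow_dvd_eval_sub_eval`). Hence `P_{d+j}` and `Q_{d+j}` depend on `a₀, …, a_{r+j}` only. -/

/-! ### Homogenizations evaluated in an arbitrary algebra. -/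

/-- The value at `(v, s)` of the degree `N` homogenization of `f`; it is linear in `f`. -/
noncomputable def homEval {d : ℕ} {E : Type*} [CommRing E] [Algebra ℂ E] (N : ℕ) (v : Fin d → E)
    (s : E) : MvPolynomial (Fin d) ℂ →ₗ[ℂ] E :=
  (MvPolynomial.basisMonomials (Fin d) ℂ).constr ℂ fun e =>
    (∏ i, v i ^ e i) * s ^ (N - ∑ i, e i)

section homEval

variable {d : ℕ} {E E' : Type*} [CommRing E] [Algebra ℂ E] [CommRing E'] [Algebra ℂ E']

theorem homEval_monomial (N : ℕ) (v : Fin d → E) (s : E) (e : Fin d →₀ ℕ) (c : ℂ) :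
    homEval N v s (MvPolynomial.monomial e c) = c • ((∏ i, v i ^ e i) * s ^ (N - ∑ i, e i)) := by
  have h : MvPolynomial.monomial e c = c • MvPolynomial.basisMonomials (Fin d) ℂ e := by
    simp [MvPolynomial.coe_basisMonomials, MvPolynomial.smul_monomial]
  rw [h, map_smul, homEval, Module.Basis.constr_basis]

theorem homEval_eq_sum (N : ℕ) (v : Fin d → E) (s : E) (f : MvPolynomial (Fin d) ℂ) :
    homEval N v s f =
      ∑ e ∈ f.support, f.coeff e • ((∏ i, v i ^ e i) * s ^ (N - ∑ i, e i)) := by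
  conv_lhs => rw [f.as_sum, map_sum]
  exact Finset.sum_congr rfl fun e _ => homEval_monomial _ _ _ _ _

theorem aeval_homogenization (v : Fin (d + 1) → E) (f : MvPolynomial (Fin d) ℂ) :
    MvPolynomial.aeval v (homogenization f) =
      homEval f.totalDegree (fun i => v i.castSucc) (v (Fin.last d)) f := by
  rw [homEval_eq_sum, homogenization, map_sum]
  refine Finset.sum_congr rfl fun e _ => ?_
  simp only [map_mul, map_prod, map_pow, MvPolynomial.aeval_X, MvPolynomial.aeval_C]
  rw [Algebra.smul_def, mul_assoc]

theorem map_homEval (φ : E →ₐ[ℂ] E') (N : ℕ) (v : Fin d → E) (s : E)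
    (f : MvPolynomial (Fin d) ℂ) :
    φ (homEval N v s f) = homEval N (fun i => φ (v i)) (φ s) f := by
  simp only [homEval_eq_sum, map_sum, map_smul, map_mul, map_prod, map_pow]

theorem sum_le_totalDegree {f : MvPolynomial (Fin d) ℂ} {e : Fin d →₀ ℕ} (he : e ∈ f.support) :
    ∑ i, e i ≤ f.totalDegree := by
  have h := MvPolynomial.le_totalDegree he
  rwa [Finsupp.sum_fintype _ _ fun _ => rfl] at h

/-- Homogeneity. The degree bound makes the natural-number exponents `N - ∑ i, e i` honest
differences. -/
theorem homEval_smul (N : ℕ) (x : Fin d → E) (s : E) (f : MvPolynomial (Fin d) ℂ)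
    (hf : f.totalDegree ≤ N) :
    homEval N (fun i => s * x i) s f = s ^ N * MvPolynomial.aeval x f := by
  rw [homEval_eq_sum, MvPolynomial.aeval_def, MvPolynomial.eval₂_eq', Finset.mul_sum]
  refine Finset.sum_congr rfl fun e he => ?_
  have h := (sum_le_totalDegree he).trans hf
  simp only [mul_pow, Finset.prod_mul_distrib, Finset.prod_pow_eq_pow_sum]
  rw [Algebra.smul_def]
  conv_rhs => rw [← Nat.sub_add_cancel h, pow_add]
  ring

theorem exists_mapDomain_castSucc (e : Fin 2 →₀ ℕ) :
    ∃ e' : Fin 3 →₀ ℕ, e.mapDomain Fin.castSucc = e' ∧ e' 0 = e 0 ∧ e' 1 = e 1 ∧ e' 2 = 0 :=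
  ⟨_, rfl, Finsupp.mapDomain_apply (Fin.castSucc_injective 2) e 0,
    Finsupp.mapDomain_apply (Fin.castSucc_injective 2) e 1,
    Finsupp.mapDomain_of_notMem_range e 2 (by simp)⟩

/-- The homogenization, evaluated, of `x₃ h₂ - h₁`. -/
theorem homEval_liftPolynomial (N : ℕ) (x y z s : E) (h₁ h₂ : MvPolynomial (Fin 2) ℂ) :
    homEval N ![x, y, z] s (liftPolynomial h₁ h₂) =
      z * homEval (N - 1) ![x, y] s h₂ - homEval N ![x, y] s h₁ := by
  rw [liftPolynomial, map_sub]
  congr 1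
  · induction h₂ using MvPolynomial.induction_on' with
    | monomial e c =>
      obtain ⟨e', h, h0, h1, h2⟩ := exists_mapDomain_castSucc e
      -- The factor `x₃` uses up one degree. Since `N - (1 + |e|) = (N - 1) - |e|` also for
      -- truncated subtraction, no degree bound is needed.
      rw [MvPolynomial.rename_monomial, h, MvPolynomial.X, MvPolynomial.monomial_mul,
        homEval_monomial, homEval_monomial, one_mul, mul_smul_comm]
      simp [Fin.prod_univ_three, Fin.sum_univ_three, Nat.sub_sub, add_comm 1, h0, h1, h2]
      ring_nf
    | add p q hp hq => simp only [map_add, mul_add, hp, hq]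
  · induction h₁ using MvPolynomial.induction_on' with
    | monomial e c =>
      obtain ⟨e', h, h0, h1, h2⟩ := exists_mapDomain_castSucc e
      rw [MvPolynomial.rename_monomial, h, homEval_monomial, homEval_monomial]
      simp [Fin.prod_univ_three, Fin.sum_univ_three, h0, h1, h2]
    | add p q hp hq => simp only [map_add, hp, hq]

/-- Every monomial of `x₃ h₂` contains `x₃` and none of `h₁` does, so nothing cancels in `f₃`; the
bounds on `deg h₁` and `deg h₂` below rest on this. -/
theorem coeff_liftPolynomial_left (h₁ h₂ : MvPolynomial (Fin 2) ℂ) (e : Fin 2 →₀ ℕ) :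
    (liftPolynomial h₁ h₂).coeff (e.mapDomain Fin.castSucc) = -h₁.coeff e := by
  obtain ⟨e', h, -, -, h2⟩ := exists_mapDomain_castSucc e
  rw [liftPolynomial, MvPolynomial.coeff_sub,
    MvPolynomial.coeff_rename_mapDomain _ (Fin.castSucc_injective 2), MvPolynomial.coeff_X_mul',
    if_neg (by rw [h]; simp [h2]), zero_sub]

theorem coeff_liftPolynomial_right (h₁ h₂ : MvPolynomial (Fin 2) ℂ) (e : Fin 2 →₀ ℕ) :
    (liftPolynomial h₁ h₂).coeff (Finsupp.single 2 1 + e.mapDomain Fin.castSucc) =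
      h₂.coeff e := by
  rw [liftPolynomial, MvPolynomial.coeff_sub, MvPolynomial.coeff_X_mul,
    MvPolynomial.coeff_rename_mapDomain _ (Fin.castSucc_injective 2),
    MvPolynomial.coeff_rename_eq_zero, sub_zero]
  intro u hu
  obtain ⟨e', h, -, -, h2⟩ := exists_mapDomain_castSucc e
  obtain ⟨u', h', -, -, h2'⟩ := exists_mapDomain_castSucc u
  rw [h, h'] at hu
  simp [hu, h2] at h2'

theorem totalDegree_left_le_liftPolynomial (h₁ h₂ : MvPolynomial (Fin 2) ℂ) :
    h₁.totalDegree ≤ (liftPolynomial h₁ h₂).totalDegree := by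
  refine Finset.sup_le fun e he => ?_
  have h : e.mapDomain Fin.castSucc ∈ (liftPolynomial h₁ h₂).support := by
    rw [MvPolynomial.mem_support_iff, coeff_liftPolynomial_left, neg_ne_zero]
    exact MvPolynomial.mem_support_iff.1 he
  have := sum_le_totalDegree h
  rw [Finsupp.sum_fintype _ _ fun _ => rfl]
  obtain ⟨e', h', h0, h1, h2⟩ := exists_mapDomain_castSucc e
  rw [h'] at this
  simpa [Fin.sum_univ_three, h0, h1, h2] using this

theorem totalDegree_right_lt_liftPolynomial (h₁ h₂ : MvPolynomial (Fin 2) ℂ) (h : h₂ ≠ 0) :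
    h₂.totalDegree + 1 ≤ (liftPolynomial h₁ h₂).totalDegree := by
  obtain ⟨e, he, hdeg⟩ := Finset.exists_mem_eq_sup h₂.support
    (MvPolynomial.support_nonempty.2 h) fun e => e.sum fun _ n => n
  have h : Finsupp.single 2 1 + e.mapDomain Fin.castSucc ∈ (liftPolynomial h₁ h₂).support := by
    rw [MvPolynomial.mem_support_iff, coeff_liftPolynomial_right]
    exact MvPolynomial.mem_support_iff.1 he
  have := sum_le_totalDegree h
  rw [MvPolynomial.totalDegree, hdeg, Finsupp.sum_fintype _ _ fun _ => rfl]
  obtain ⟨e', h', h0, h1, h2⟩ := exists_mapDomain_castSucc e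
  rw [h'] at this
  simpa [Fin.sum_univ_three, h0, h1, h2] using this

/-! ### Passing from `t` to `u = 1/t` by reversing coefficients. -/

-- Under a degree bound `N`, `reflect N p` is `t ^ N * p(1/t)`; in this form multiplicativity is
-- clear, and it carries over to homogeneous forms in `homEval_reflect`.
open Polynomial in
theorem prod_reflect {A ι : Type*} [CommRing A] (s : Finset ι) (v : ι → A[X]) (N : ι → ℕ)
    (h : ∀ i ∈ s, (v i).natDegree ≤ N i) :
    ∏ i ∈ s, reflect (N i) (v i) = reflect (∑ i ∈ s, N i) (∏ i ∈ s, v i) := by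
  classical
  induction s using Finset.induction_on with
  | empty => simp
  | insert i s hi ih =>
    rw [Finset.prod_insert hi, Finset.prod_insert hi, Finset.sum_insert hi,
      ih fun j hj => h j (Finset.mem_insert_of_mem hj), reflect_mul]
    · exact h i (Finset.mem_insert_self _ _)
    · exact (natDegree_prod_le _ _).trans
        (Finset.sum_le_sum fun j hj => h j (Finset.mem_insert_of_mem hj))

open Polynomial in
theorem pow_reflect {A : Type*} [CommRing A] (v : A[X]) (N m : ℕ) (h : v.natDegree ≤ N) :
    reflect N v ^ m = reflect (m * N) (v ^ m) := by
  have := prod_reflect (Finset.range m) (fun _ => v) (fun _ => N) fun _ _ => h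
  simpa using this

open Polynomial in
theorem homEval_reflect {A : Type*} [CommRing A] [Algebra ℂ A] (D N : ℕ) (v : Fin d → A[X])
    (s : A[X]) (f : MvPolynomial (Fin d) ℂ) (hf : f.totalDegree ≤ D)
    (hv : ∀ i, (v i).natDegree ≤ N) (hs : s.natDegree ≤ N) :
    homEval D (fun i => reflect N (v i)) (reflect N s) f = reflect (D * N) (homEval D v s f) := by
  have key : ∀ e ∈ f.support,
      (∏ i, reflect N (v i) ^ e i) * reflect N s ^ (D - ∑ i, e i) =
        reflect (D * N) ((∏ i, v i ^ e i) * s ^ (D - ∑ i, e i)) := by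
    intro e he
    have h := (sum_le_totalDegree he).trans hf
    have hdeg : ∀ (p : A[X]) (m : ℕ), p.natDegree ≤ N → (p ^ m).natDegree ≤ m * N :=
      fun p m hp => natDegree_pow_le.trans (Nat.mul_le_mul_left _ hp)
    simp only [pow_reflect _ _ _ (hv _), pow_reflect _ _ _ hs]
    rw [prod_reflect _ _ _ fun i _ => hdeg _ _ (hv i), ← reflect_mul, ← Finset.sum_mul, ← add_mul,
      Nat.add_sub_cancel' h]
    · exact (natDegree_prod_le _ _).trans (Finset.sum_le_sum fun i _ => hdeg _ _ (hv i))
    · exact hdeg _ _ hs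
  rw [homEval_eq_sum, homEval_eq_sum, Finset.sum_congr rfl fun e he => by rw [key e he]]
  ext i
  simp [coeff_reflect]

end homEval

open Polynomial in
theorem natDegree_homEval_le {d : ℕ} {A : Type*} [CommRing A] [Algebra ℂ A] (D N : ℕ)
    (v : Fin d → A[X]) (s : A[X]) (f : MvPolynomial (Fin d) ℂ) (hf : f.totalDegree ≤ D)
    (hv : ∀ i, (v i).natDegree ≤ N) (hs : s.natDegree ≤ N) :
    (homEval D v s f).natDegree ≤ D * N := by
  rw [homEval_eq_sum]
  refine natDegree_sum_le_of_forall_le _ _ fun e he => ?_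
  have h := (sum_le_totalDegree he).trans hf
  have hdeg : ∀ (p : A[X]) (m : ℕ), p.natDegree ≤ N → (p ^ m).natDegree ≤ m * N :=
    fun p m hp => natDegree_pow_le.trans (Nat.mul_le_mul_left _ hp)
  refine (natDegree_smul_le _ _).trans (natDegree_mul_le.trans ?_)
  conv_rhs => rw [← Nat.add_sub_cancel' h, add_mul, Finset.sum_mul]
  exact Nat.add_le_add ((natDegree_prod_le _ _).trans
    (Finset.sum_le_sum fun i _ => hdeg _ _ (hv i))) (hdeg _ _ hs)

/-! ### The series `P` and `Q` along a branch and their response to perturbations. -/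

/-- The degree `N` homogenization of `h` at `(1, y, u ^ k)`. -/
noncomputable def branchEval {E : Type*} [CommRing E] [Algebra ℂ E] (N k : ℕ)
    (h : MvPolynomial (Fin 2) ℂ) (y u : E) : E :=
  homEval N ![1, y] (u ^ k) h

theorem map_branchEval {E E' : Type*} [CommRing E] [Algebra ℂ E] [CommRing E'] [Algebra ℂ E']
    (φ : E →ₐ[ℂ] E') (N k : ℕ) (h : MvPolynomial (Fin 2) ℂ) (y u : E) :
    φ (branchEval N k h y u) = branchEval N k h (φ y) (φ u) := by
  rw [branchEval, map_homEval, branchEval, map_pow]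
  congr 2
  funext i
  fin_cases i <;> simp

open PowerSeries in
/-- A perturbation of order `r + 1` that moves no coefficient up to order `d` loses at least
`d + 1` orders. -/
theorem X_pow_dvd_eval_sub_eval (P : Polynomial ℂ⟦X⟧) (α : ℂ⟦X⟧) (r d j : ℕ)
    (H : ∀ c : ℂ, X ^ (d + 1) ∣ P.eval (α + X ^ (r + 1) * C c) - P.eval α)
    {y z : ℂ⟦X⟧} (hy : X ^ (r + 1) ∣ y - α) (hyz : X ^ (r + 1 + j) ∣ y - z) :
    X ^ (d + 1 + j) ∣ P.eval y - P.eval z := by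
  -- Expand in the perturbation: `Q(γ) = P(α + X ^ (r+1) γ)`. The claim reduces to `X ^ (d+1)`
  -- dividing every non-constant coefficient of `Q`.
  set Q : Polynomial ℂ⟦X⟧ :=
    P.comp (Polynomial.C α + Polynomial.C (X ^ (r + 1)) * Polynomial.X) with hQ
  have hQe : ∀ γ, Q.eval γ = P.eval (α + X ^ (r + 1) * γ) := fun γ => by simp [hQ]
  have hcoeff : ∀ l, l ≠ 0 → X ^ (d + 1) ∣ Q.coeff l := by
    intro l hl
    rw [X_pow_dvd_iff]
    intro i hi
    -- For constant `γ = c`, the `i`-th coefficient of `Q(c)` is a polynomial in `c`. By `H` it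
    -- takes one value on all of `ℂ`, so its coefficients of positive degree vanish.
    set q : Polynomial ℂ := ∑ l ∈ Finset.range (Q.natDegree + 1),
      Polynomial.C (coeff i (Q.coeff l)) * Polynomial.X ^ l with hq
    have hqe : ∀ c, q.eval c = coeff i (Q.eval (C c)) := by
      intro c
      rw [Polynomial.eval_eq_sum_range (p := Q), hq, Polynomial.eval_finsetSum, map_sum]
      refine Finset.sum_congr rfl fun l _ => ?_
      rw [Polynomial.eval_mul, Polynomial.eval_C, Polynomial.eval_pow, Polynomial.eval_X,
        ← map_pow, coeff_mul_C]
    have hconst : q = Polynomial.C (coeff i (Q.eval 0)) := by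
      refine Polynomial.funext fun c => ?_
      have := X_pow_dvd_iff.1 (H c) i hi
      rw [map_sub, sub_eq_zero] at this
      rw [hqe, hQe, hQe, this]
      simp
    have hql : q.coeff l = coeff i (Q.coeff l) := by
      simp only [hq, Polynomial.finsetSum_coeff, Polynomial.coeff_C_mul, Polynomial.coeff_X_pow,
        mul_ite, mul_one, mul_zero, Finset.sum_ite_eq, Finset.mem_range]
      split_ifs with hlt
      · rfl
      · rw [Polynomial.coeff_eq_zero_of_natDegree_lt (by omega), map_zero]
    rw [← hql, hconst, Polynomial.coeff_C_of_ne_zero hl]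
  obtain ⟨γ, hγ⟩ := hy
  obtain ⟨η, hη⟩ := hyz
  have hy' : y = α + X ^ (r + 1) * γ := by rw [← hγ]; ring
  have hz' : z = α + X ^ (r + 1) * (γ - X ^ j * η) := by
    rw [mul_sub, ← hγ, ← mul_assoc, ← pow_add, ← hη]; ring
  rw [hy', hz', ← hQe, ← hQe, Polynomial.eval_eq_sum_range, Polynomial.eval_eq_sum_range,
    ← Finset.sum_sub_distrib]
  refine Finset.dvd_sum fun l _ => ?_
  rcases eq_or_ne l 0 with rfl | hl
  · simp
  rw [← mul_sub, pow_add]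
  -- The coefficient of `Q` supplies `d + 1` orders; the difference of `l`-th powers supplies the
  -- other `j`, since the two arguments differ by `X ^ j * η`.
  refine mul_dvd_mul (hcoeff l hl) (dvd_trans ?_ (sub_dvd_pow_sub_pow _ _ l))
  rw [sub_sub_cancel]
  exact dvd_mul_right _ _

-- Reading `branchEval` as a polynomial in `y` over `ℂ⟦X⟧` makes the perturbation lemma for
-- polynomials applicable.
open PowerSeries in
theorem eval_branchEval (N k : ℕ) (h : MvPolynomial (Fin 2) ℂ) (α : ℂ⟦X⟧) :
    (branchEval N k h (Polynomial.X : Polynomial ℂ⟦X⟧) (Polynomial.C X)).eval α =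
      branchEval N k h α X := by
  have := map_branchEval ((Polynomial.aeval (R := ℂ⟦X⟧) α).restrictScalars ℂ) N k h
    Polynomial.X (Polynomial.C X)
  simpa [Polynomial.coe_aeval_eq_eval] using this

open PowerSeries in
theorem X_pow_dvd_branchEval_sub (N k : ℕ) (h : MvPolynomial (Fin 2) ℂ) (α : ℂ⟦X⟧) (r d j : ℕ)
    (H : ∀ c : ℂ, X ^ (d + 1) ∣ branchEval N k h (α + X ^ (r + 1) * C c) X - branchEval N k h α X)
    {y z : ℂ⟦X⟧} (hy : X ^ (r + 1) ∣ y - α) (hyz : X ^ (r + 1 + j) ∣ y - z) :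
    X ^ (d + 1 + j) ∣ branchEval N k h y X - branchEval N k h z X := by
  simp only [← eval_branchEval] at H ⊢
  exact X_pow_dvd_eval_sub_eval _ α r d j H hy hyz

open PowerSeries in
theorem sub_dvd_branchEval_sub (N k : ℕ) (h : MvPolynomial (Fin 2) ℂ) (y z : ℂ⟦X⟧) :
    y - z ∣ branchEval N k h y X - branchEval N k h z X := by
  simp only [← eval_branchEval]
  exact Polynomial.sub_dvd_eval_sub _ _ _

/-! ### The substituted polynomial in `u`, with undetermined `bᵢ`. -/

section symbolic

open Polynomial

/-- The polynomial `b₀ + b₁ u + ⋯ + b_M u ^ M` with undetermined coefficients. -/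
noncomputable def symbolicSeries (M : ℕ) : (MvPolynomial ℕ ℂ)[X] :=
  ∑ i ∈ Finset.range (M + 1), C (MvPolynomial.X i) * X ^ i

theorem coeff_symbolicSeries {M i : ℕ} (h : i ≤ M) :
    (symbolicSeries M).coeff i = MvPolynomial.X i := by
  simp [symbolicSeries, Nat.lt_succ_of_le h]

theorem natDegree_symbolicSeries_le (M : ℕ) : (symbolicSeries M).natDegree ≤ M :=
  natDegree_sum_le_of_forall_le _ _ fun _ hi =>
    (natDegree_C_mul_X_pow_le _ _).trans (Nat.lt_succ_iff.1 (Finset.mem_range.1 hi))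

/-- For `i > j` the unknown `bᵢ` meets a coefficient of `P` of index below `d`, which is zero. This
is the source of triangularity. -/
theorem coeff_symbolicSeries_mul_sub {M d j : ℕ} {P Q : ℂ[X]} (hP : ∀ i < d, P.coeff i = 0)
    (hj : j ≤ M) :
    (symbolicSeries M * P.map MvPolynomial.C - Q.map MvPolynomial.C).coeff (d + j) =
      ∑ i ∈ Finset.range (j + 1), MvPolynomial.X i * MvPolynomial.C (P.coeff (d + j - i)) -
        MvPolynomial.C (Q.coeff (d + j)) := by
  rw [coeff_sub, coeff_map, coeff_mul, Finset.Nat.sum_antidiagonal_eq_sum_range_succ_mk]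
  refine congrArg₂ _ ?_ rfl
  rw [← Finset.sum_subset (s₁ := Finset.range (j + 1)) (Finset.range_mono (by omega))]
  · refine Finset.sum_congr rfl fun i hi => ?_
    rw [Finset.mem_range] at hi
    rw [coeff_symbolicSeries (by omega), coeff_map]
  · intro i hi hi'
    rw [Finset.mem_range] at hi hi'
    rw [coeff_map, hP _ (by omega), map_zero, mul_zero]

/-- The lowest coefficient has the form `b₀ Pᵢ - Qᵢ` with `b₀` free, so its vanishing forces `Pᵢ =
Qᵢ = 0`; the values at `b₀ = 0` and `b₀ = 1` show this. -/
theorem coeff_eq_zero_of_coeff_symbolicSeries_mul_sub {M d : ℕ} {P Q : ℂ[X]}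
    (h : ∀ i < d, (symbolicSeries M * P.map MvPolynomial.C -
      Q.map MvPolynomial.C : (MvPolynomial ℕ ℂ)[X]).coeff i = 0) :
    ∀ i < d, P.coeff i = 0 ∧ Q.coeff i = 0 := by
  intro i
  induction i using Nat.strong_induction_on with
  | _ i ih =>
    intro hi
    have h0 := h i hi
    have := coeff_symbolicSeries_mul_sub (M := M) (d := i) (j := 0) (Q := Q)
      (fun l hl => (ih l hl (hl.trans hi)).1) (Nat.zero_le _)
    rw [add_zero, h0] at this
    have e0 := congrArg (MvPolynomial.eval fun _ => (0 : ℂ)) this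
    have e1 := congrArg (MvPolynomial.eval fun _ => (1 : ℂ)) this
    simp at e0 e1
    rw [e0] at e1
    simp at e1
    exact ⟨e1.symm, e0⟩

theorem natDegree_reflect_add {A : Type*} [CommRing A] {S : A[X]} {L d : ℕ} (hS : S.natDegree ≤ L)
    (h0 : ∀ i < d, S.coeff i = 0) (hd : S.coeff d ≠ 0) : (reflect L S).natDegree + d = L := by
  have hdL : d ≤ L := (le_natDegree_of_ne_zero hd).trans hS
  suffices (reflect L S).natDegree = L - d by omega
  refine natDegree_eq_of_le_of_coeff_ne_zero ?_ ?_
  · rw [natDegree_le_iff_coeff_eq_zero]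
    intro i hi
    rw [coeff_reflect]
    rcases le_or_gt i L with h | h
    · rw [revAt_le h, h0 _ (by omega)]
    · rw [revAt_eq_self_of_lt h, coeff_eq_zero_of_natDegree_lt (by omega)]
  · rwa [coeff_reflect, revAt_le (by omega), Nat.sub_sub_self hdL]

theorem coeff_reflect_natDegree_sub {A : Type*} [CommRing A] {S : A[X]} {L d j : ℕ}
    (h : (reflect L S).natDegree + d = L) (hj : j ≤ (reflect L S).natDegree) :
    (reflect L S).coeff ((reflect L S).natDegree - j) = S.coeff (d + j) := by
  rw [coeff_reflect, revAt_le (by omega)]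
  congr 1
  omega

theorem coeff_eq_zero_of_natDegree_reflect_add {A : Type*} [CommRing A] {S : A[X]} {L d : ℕ}
    (h : (reflect L S).natDegree + d = L) : ∀ i < d, S.coeff i = 0 := by
  intro i hi
  have : (reflect L S).coeff (L - i) = 0 := coeff_eq_zero_of_natDegree_lt (by omega)
  rwa [coeff_reflect, revAt_le (by omega), Nat.sub_sub_self (by omega)] at this

theorem reflect_sum_C_mul_X_pow {A : Type*} [CommRing A] (c : ℕ → A) {L M : ℕ} (h : M ≤ L) :
    reflect L (∑ i ∈ Finset.range (M + 1), C (c i) * X ^ i) =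
      ∑ i ∈ Finset.range (M + 1), C (c i) * X ^ (L - i) := by
  induction M with
  | zero => simp
  | succ M ih =>
    rw [Finset.sum_range_succ, reflect_add, ih (by omega), reflect_C_mul_X_pow, revAt_le h,
      ← Finset.sum_range_succ]

/-- The polynomial `a₀ + a₁ u + ⋯ + a_N u ^ N`. -/
noncomputable def truncatedSeries (a : ℕ → ℂ) (N : ℕ) : ℂ[X] :=
  ∑ i ∈ Finset.range (N + 1), C (a i) * X ^ i

theorem coeff_truncatedSeries (a : ℕ → ℂ) (N i : ℕ) :
    (truncatedSeries a N).coeff i = if i ≤ N then a i else 0 := by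
  simp [truncatedSeries]

theorem natDegree_truncatedSeries_le (a : ℕ → ℂ) (N : ℕ) : (truncatedSeries a N).natDegree ≤ N :=
  natDegree_sum_le_of_forall_le _ _ fun _ hi =>
    (natDegree_C_mul_X_pow_le _ _).trans (Nat.lt_succ_iff.1 (Finset.mem_range.1 hi))

/-- The substituted polynomial in the variable `u = 1 / t`. -/
noncomputable def reversedSubstitution (h₁ h₂ : MvPolynomial (Fin 2) ℂ) (k : ℕ) (a : ℕ → ℂ)
    (n m : ℕ) : (MvPolynomial ℕ ℂ)[X] :=
  symbolicSeries (m + k) *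
      (branchEval ((liftPolynomial h₁ h₂).totalDegree - 1) k h₂
        (truncatedSeries a (n + k)) X).map MvPolynomial.C -
    (branchEval (liftPolynomial h₁ h₂).totalDegree k h₁
        (truncatedSeries a (n + k)) X).map MvPolynomial.C

theorem homEval_eq_reversedSubstitution (h₁ h₂ : MvPolynomial (Fin 2) ℂ) (k : ℕ) (a : ℕ → ℂ)
    (n m : ℕ) :
    homEval (liftPolynomial h₁ h₂).totalDegree
      ![1, (truncatedSeries a (n + k)).map MvPolynomial.C, symbolicSeries (m + k)] (X ^ k)
        (liftPolynomial h₁ h₂) = reversedSubstitution h₁ h₂ k a n m := by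
  have key : ∀ (N : ℕ) (h : MvPolynomial (Fin 2) ℂ) (p : ℂ[X]),
      (branchEval N k h p X).map (MvPolynomial.C : ℂ →+* MvPolynomial ℕ ℂ) =
        branchEval N k h (p.map MvPolynomial.C) X := by
    intro N h p
    have := map_branchEval (Polynomial.mapAlgHom (Algebra.ofId ℂ (MvPolynomial ℕ ℂ))) N k h p X
    simpa [Polynomial.mapAlgHom] using this
  rw [homEval_liftPolynomial, reversedSubstitution, key, key, branchEval, branchEval]

/-- Each of the four arguments is `t ^ (n+k)` times a polynomial in `u = 1/t`; homogeneity of degree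
`D` collects these factors into `t ^ (D (n+k))`. -/
theorem truncatedSubstitution_eq_reflect (h₁ h₂ : MvPolynomial (Fin 2) ℂ) (k : ℕ) (a : ℕ → ℂ)
    (n m : ℕ) (hmn : m ≤ n) :
    truncatedSubstitution (liftPolynomial h₁ h₂) k a n m =
        reflect ((liftPolynomial h₁ h₂).totalDegree * (n + k))
          (reversedSubstitution h₁ h₂ k a n m) ∧
      (reversedSubstitution h₁ h₂ k a n m).natDegree ≤
        (liftPolynomial h₁ h₂).totalDegree * (n + k) := by
  have hv : ∀ i, (![1, (truncatedSeries a (n + k)).map MvPolynomial.C,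
      symbolicSeries (m + k)] i : (MvPolynomial ℕ ℂ)[X]).natDegree ≤ n + k := by
    intro i
    fin_cases i
    · simp
    · exact natDegree_map_le.trans (natDegree_truncatedSeries_le _ _)
    · exact (natDegree_symbolicSeries_le _).trans (by omega)
  have hs : (X ^ k : (MvPolynomial ℕ ℂ)[X]).natDegree ≤ n + k :=
    (natDegree_X_pow_le k).trans (by omega)
  rw [← homEval_eq_reversedSubstitution]
  refine ⟨?_, natDegree_homEval_le _ _ _ _ _ le_rfl hv hs⟩
  rw [← homEval_reflect _ _ _ _ _ le_rfl hv hs, truncatedSubstitution, aeval_homogenization]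
  congr 2
  · funext i
    fin_cases i
    · simp
    · simp only [truncatedSeries, Polynomial.map_sum, Polynomial.map_mul, Polynomial.map_C,
        Polynomial.map_pow, Polynomial.map_X]
      exact (reflect_sum_C_mul_X_pow (fun i => MvPolynomial.C (a i)) le_rfl).symm
    · refine Eq.trans ?_ (reflect_sum_C_mul_X_pow MvPolynomial.X
        (show m + k ≤ n + k by omega)).symm
      refine (Finset.mul_sum _ _ _).trans (Finset.sum_congr rfl fun i hi => ?_)
      rw [Finset.mem_range] at hi
      -- The exponents combine as `(n - m) + (m + k - i) = n + k - i`, which uses `m ≤ n` and `i ≤ m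
      -- + k`.
      rw [mul_left_comm, ← pow_add]
      congr 2
      omega
  · rw [reflect_monomial, revAt_le (by omega)]
    simp

end symbolic

/-! ### The coefficients `Λ_j` from the formal identity `β P = Q`. -/

section formal

open PowerSeries

theorem exists_order_data {p : ℂ⟦X⟧} (hp : p ≠ 0) :
    ∃ d, coeff d p ≠ 0 ∧ ∀ i < d, coeff i p = 0 := by
  classical
  have h : ∃ d, coeff d p ≠ 0 := exists_coeff_ne_zero_iff_ne_zero.2 hp
  exact ⟨Nat.find h, Nat.find_spec h, fun i hi => not_not.1 (Nat.find_min h hi)⟩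

theorem coeff_eq_of_X_pow_dvd_sub {p q : ℂ⟦X⟧} {N i : ℕ} (h : X ^ N ∣ p - q) (hi : i < N) :
    coeff i p = coeff i q := by
  have := X_pow_dvd_iff.1 h i hi
  rwa [map_sub, sub_eq_zero] at this

theorem X_pow_dvd_sub_of_coeff_eq {p q : ℂ⟦X⟧} {N : ℕ} (h : ∀ i < N, coeff i p = coeff i q) :
    X ^ N ∣ p - q :=
  X_pow_dvd_iff.2 fun i hi => by rw [map_sub, h i hi, sub_self]

theorem coeff_coe_truncatedSeries (a : ℕ → ℂ) (N i : ℕ) :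
    coeff i (truncatedSeries a N : ℂ⟦X⟧) = if i ≤ N then a i else 0 := by
  rw [Polynomial.coeff_coe, coeff_truncatedSeries]

theorem coeff_branchEval_coe (N k : ℕ) (h : MvPolynomial (Fin 2) ℂ) (p : Polynomial ℂ) (i : ℕ) :
    (branchEval N k h p Polynomial.X).coeff i = coeff i (branchEval N k h (p : ℂ⟦X⟧) X) := by
  have := map_branchEval (Polynomial.coeToPowerSeries.algHom (R := ℂ) ℂ) N k h p Polynomial.X
  simp only [Polynomial.coeToPowerSeries.algHom_apply, Algebra.algebraMap_self,
    PowerSeries.map_id, id, Polynomial.coe_X] at this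
  rw [← this, Polynomial.coeff_coe]

theorem map_coeff_branchEval {R R' : Type*} [CommRing R] [Algebra ℂ R] [CommRing R'] [Algebra ℂ R']
    (φ : R →ₐ[ℂ] R') (N k : ℕ) (h : MvPolynomial (Fin 2) ℂ) (p : Polynomial R) (i : ℕ) :
    φ ((branchEval N k h p Polynomial.X).coeff i) =
      (branchEval N k h (p.map (φ : R →+* R')) Polynomial.X).coeff i := by
  have := map_branchEval (Polynomial.mapAlgHom φ) N k h p Polynomial.X
  simp only [Polynomial.mapAlgHom, AlgHom.coe_mk, AlgHom.toRingHom_eq_coe, Polynomial.coe_mapRingHom,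
    Polynomial.map_X] at this
  rw [← this, Polynomial.coeff_map]
  rfl

variable {h₁ h₂ : MvPolynomial (Fin 2) ℂ} {k d : ℕ} {a : ℕ → ℂ}

local notation "D" => MvPolynomial.totalDegree (liftPolynomial h₁ h₂)

/-- The truncated series agree with those at `α` through order `d`, so the lowest term in `u` is
`(b₀ P_d - Q_d) u ^ d`. It is nonzero for symbolic `b₀` because `P_d ≠ 0`, whatever `Q_d` is. -/
theorem expansion_of_X_pow_dvd {a' : ℕ → ℂ} {n m : ℕ} (hmn : m ≤ n) {α : ℂ⟦X⟧}
    (hd : coeff d (branchEval (D - 1) k h₂ α X) ≠ 0)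
    (hd₂ : ∀ i < d, coeff i (branchEval (D - 1) k h₂ α X) = 0)
    (hd₁ : ∀ i < d, coeff i (branchEval D k h₁ α X) = 0)
    (H₂ : X ^ (d + 1) ∣ branchEval (D - 1) k h₂ (truncatedSeries a' (n + k) : ℂ⟦X⟧) X -
      branchEval (D - 1) k h₂ α X)
    (H₁ : X ^ (d + 1) ∣ branchEval D k h₁ (truncatedSeries a' (n + k) : ℂ⟦X⟧) X -
      branchEval D k h₁ α X) :
    expansionDegree (liftPolynomial h₁ h₂) k a' n m + d = D * (n + k) ∧
      ∀ j ≤ m + k, j ≤ expansionDegree (liftPolynomial h₁ h₂) k a' n m →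
        expansionCoeff (liftPolynomial h₁ h₂) k a' n m j =
          ∑ i ∈ Finset.range (j + 1), MvPolynomial.X i * MvPolynomial.C
            (coeff (d + j - i) (branchEval (D - 1) k h₂ (truncatedSeries a' (n + k) : ℂ⟦X⟧) X)) -
          MvPolynomial.C
            (coeff (d + j) (branchEval D k h₁ (truncatedSeries a' (n + k) : ℂ⟦X⟧) X)) := by
  obtain ⟨hT, hdeg⟩ := truncatedSubstitution_eq_reflect h₁ h₂ k a' n m hmn
  simp only [← coeff_branchEval_coe]
  have e₂ : ∀ i ≤ d, (branchEval (D - 1) k h₂ (truncatedSeries a' (n + k)) Polynomial.X).coeff i =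
      coeff i (branchEval (D - 1) k h₂ α X) := fun i hi => by
    rw [coeff_branchEval_coe, coeff_eq_of_X_pow_dvd_sub H₂ (Nat.lt_succ_of_le hi)]
  have e₁ : ∀ i ≤ d, (branchEval D k h₁ (truncatedSeries a' (n + k)) Polynomial.X).coeff i =
      coeff i (branchEval D k h₁ α X) := fun i hi => by
    rw [coeff_branchEval_coe, coeff_eq_of_X_pow_dvd_sub H₁ (Nat.lt_succ_of_le hi)]
  have hS : ∀ i ≤ d, (reversedSubstitution h₁ h₂ k a' n m).coeff i =
      MvPolynomial.X 0 * MvPolynomial.C (coeff i (branchEval (D - 1) k h₂ α X)) -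
        MvPolynomial.C (coeff i (branchEval D k h₁ α X)) := by
    intro i hi
    have := coeff_symbolicSeries_mul_sub (M := m + k) (d := i) (j := 0)
      (P := branchEval (D - 1) k h₂ (truncatedSeries a' (n + k)) Polynomial.X)
      (Q := branchEval D k h₁ (truncatedSeries a' (n + k)) Polynomial.X)
      (fun l hl => by rw [e₂ _ (by omega), hd₂ _ (by omega)]) (Nat.zero_le _)
    rw [reversedSubstitution, ← add_zero i, this]
    simp [e₂ i hi, e₁ i hi]
  have hdegree : expansionDegree (liftPolynomial h₁ h₂) k a' n m + d = D * (n + k) := by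
    rw [expansionDegree, hT]
    refine natDegree_reflect_add hdeg (fun i hi => ?_) fun h0 => hd ?_
    · rw [hS i hi.le, hd₂ i hi, hd₁ i hi]
      simp
    · rw [hS d le_rfl] at h0
      have z0 := congrArg (MvPolynomial.eval fun _ => (0 : ℂ)) h0
      have z1 := congrArg (MvPolynomial.eval fun _ => (1 : ℂ)) h0
      simp only [map_sub, map_mul, MvPolynomial.eval_X, MvPolynomial.eval_C, map_zero] at z0 z1
      linear_combination z1 - z0
  refine ⟨hdegree, fun j hj hj' => ?_⟩
  rw [expansionDegree, hT] at hdegree hj'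
  rw [expansionCoeff, expansionDegree, hT, coeff_reflect_natDegree_sub hdegree hj',
    reversedSubstitution, coeff_symbolicSeries_mul_sub _ hj]
  intro i hi
  rw [e₂ i hi.le, hd₂ i hi]

/-- The converse direction: a known degree in `t` forces both truncated series to vanish below order
`d`. -/
theorem coeff_of_expansionDegree_add {a' : ℕ → ℂ} {n : ℕ}
    (h : expansionDegree (liftPolynomial h₁ h₂) k a' n 0 + d = D * (n + k)) :
    (∀ i < d,
      coeff i (branchEval (D - 1) k h₂ (truncatedSeries a' (n + k) : ℂ⟦X⟧) X) = 0 ∧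
      coeff i (branchEval D k h₁ (truncatedSeries a' (n + k) : ℂ⟦X⟧) X) = 0) ∧
    expansionCoeff (liftPolynomial h₁ h₂) k a' n 0 0 =
      MvPolynomial.X 0 * MvPolynomial.C
        (coeff d (branchEval (D - 1) k h₂ (truncatedSeries a' (n + k) : ℂ⟦X⟧) X)) -
      MvPolynomial.C (coeff d (branchEval D k h₁ (truncatedSeries a' (n + k) : ℂ⟦X⟧) X)) := by
  obtain ⟨hT, -⟩ := truncatedSubstitution_eq_reflect h₁ h₂ k a' n 0 (Nat.zero_le _)
  simp only [← coeff_branchEval_coe]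
  rw [expansionDegree, hT] at h
  have h0 := coeff_eq_zero_of_coeff_symbolicSeries_mul_sub
    (coeff_eq_zero_of_natDegree_reflect_add h)
  refine ⟨h0, ?_⟩
  rw [expansionCoeff, expansionDegree, hT, coeff_reflect_natDegree_sub h (Nat.zero_le _),
    reversedSubstitution, coeff_symbolicSeries_mul_sub (fun i hi => (h0 i hi).1) (Nat.zero_le _)]
  simp

theorem truncatedSeries_sub_mk (a : ℕ → ℂ) (N : ℕ) :
    (X : ℂ⟦X⟧) ^ (N + 1) ∣ truncatedSeries a N - mk a :=
  X_pow_dvd_sub_of_coeff_eq fun i hi => by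
    rw [coeff_coe_truncatedSeries, if_pos (Nat.lt_succ_iff.1 hi), coeff_mk]

theorem X_pow_dvd_mk_sub_mk {a a' : ℕ → ℂ} {r : ℕ} (h : ∀ i ≤ r, a' i = a i) :
    (X : ℂ⟦X⟧) ^ (r + 1) ∣ mk a' - mk a :=
  X_pow_dvd_sub_of_coeff_eq fun i hi => by
    rw [coeff_mk, coeff_mk, h i (Nat.lt_succ_iff.1 hi)]

theorem X_pow_dvd_truncatedSeries_sub {a a' : ℕ → ℂ} {r N : ℕ} (hr : r ≤ N)
    (h : ∀ i ≤ r, a' i = a i) : (X : ℂ⟦X⟧) ^ (r + 1) ∣ truncatedSeries a' N - mk a := by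
  rw [← sub_add_sub_cancel _ (mk a')]
  exact dvd_add ((pow_dvd_pow _ (by omega)).trans (truncatedSeries_sub_mk a' N))
    (X_pow_dvd_mk_sub_mk h)

/-- If only the terms up to order `r` enter the leading term, then perturbations of order `r + 1`
change no coefficient up to the order `d` of the denominator. -/
theorem perturbation_of_leadingTermDetermined {r : ℕ}
    (hd : coeff d (branchEval (D - 1) k h₂ (mk a) X) ≠ 0)
    (hd₂ : ∀ i < d, coeff i (branchEval (D - 1) k h₂ (mk a) X) = 0)
    (hd₁ : ∀ i < d, coeff i (branchEval D k h₁ (mk a) X) = 0)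
    (hr : LeadingTermDeterminedUpTo (liftPolynomial h₁ h₂) k a r) (c : ℂ) :
    X ^ (d + 1) ∣ branchEval (D - 1) k h₂ (mk a + X ^ (r + 1) * C c) X -
        branchEval (D - 1) k h₂ (mk a) X ∧
      X ^ (d + 1) ∣ branchEval D k h₁ (mk a + X ^ (r + 1) * C c) X - branchEval D k h₁ (mk a) X := by
  -- For `n ≥ d` the truncation at `n + k` is invisible through order `d`.
  obtain ⟨n, hn, hnd⟩ := (hr.and (Filter.eventually_ge_atTop d)).exists
  set a' : ℕ → ℂ := fun i => a i + if i = r + 1 then c else 0 with ha'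
  have hα : mk a' = mk a + X ^ (r + 1) * C c := by
    ext i
    rw [coeff_mk, map_add, coeff_mk, coeff_X_pow_mul']
    simp only [ha', coeff_C]
    congr 1
    split_ifs <;> first | rfl | omega
  obtain ⟨hdeg', hΛ'⟩ := hn a' fun i hi => by simp [ha', show i ≠ r + 1 by omega]
  have hdvd : ∀ (b : ℕ → ℂ) (N : ℕ) (h : MvPolynomial (Fin 2) ℂ), X ^ (d + 1) ∣
      branchEval N k h (truncatedSeries b (n + k) : ℂ⟦X⟧) X - branchEval N k h (mk b) X :=
    fun b N h => ((pow_dvd_pow _ (by omega)).trans (truncatedSeries_sub_mk b (n + k))).trans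
      (sub_dvd_branchEval_sub _ _ _ _ _)
  obtain ⟨hdeg, hΛ⟩ := expansion_of_X_pow_dvd (m := 0) (Nat.zero_le n) hd hd₂ hd₁ (hdvd a _ _)
    (hdvd a _ _)
  obtain ⟨hlow, hlead⟩ := coeff_of_expansionDegree_add (hdeg'.symm ▸ hdeg)
  have hΛ0 := hΛ 0 (Nat.zero_le _) (Nat.zero_le _)
  rw [hΛ', hΛ0] at hlead
  -- Equality of the two leading coefficients `b₀ P_d - Q_d` is split into equality of the `Q_d` (at
  -- `b₀ = 0`) and of the `P_d` (at `b₀ = 1`).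
  have z0 := congrArg (MvPolynomial.eval fun _ => (0 : ℂ)) hlead
  have z1 := congrArg (MvPolynomial.eval fun _ => (1 : ℂ)) hlead
  simp at z0 z1
  rw [z0] at z1
  have z1' := sub_left_injective z1
  rw [← hα]
  have ha₂ := hdvd a (D - 1) h₂
  have ha₁ := hdvd a D h₁
  constructor
  · refine X_pow_dvd_sub_of_coeff_eq fun i hi => ?_
    rw [← coeff_eq_of_X_pow_dvd_sub (hdvd a' (D - 1) h₂) hi]
    rcases (Nat.lt_succ_iff.1 hi).lt_or_eq with h | rfl
    · rw [(hlow i h).1, hd₂ i h]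
    · rw [← coeff_eq_of_X_pow_dvd_sub ha₂ hi, ← z1']
  · refine X_pow_dvd_sub_of_coeff_eq fun i hi => ?_
    rw [← coeff_eq_of_X_pow_dvd_sub (hdvd a' D h₁) hi]
    rcases (Nat.lt_succ_iff.1 hi).lt_or_eq with h | rfl
    · rw [(hlow i h).2, hd₁ i h]
    · rw [← coeff_eq_of_X_pow_dvd_sub ha₁ hi, ← z0]

/-- The order `d` of `P` itself always serves as `r`, since `y - z` divides the difference of the
values at `y` and `z`. -/
theorem exists_leadingTermDeterminedUpTo
    (hd : coeff d (branchEval (D - 1) k h₂ (mk a) X) ≠ 0)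
    (hd₂ : ∀ i < d, coeff i (branchEval (D - 1) k h₂ (mk a) X) = 0)
    (hd₁ : ∀ i < d, coeff i (branchEval D k h₁ (mk a) X) = 0) :
    LeadingTermDeterminedUpTo (liftPolynomial h₁ h₂) k a d := by
  filter_upwards [Filter.eventually_ge_atTop d] with n hn a' ha'
  have key : ∀ (b : ℕ → ℂ), (∀ i ≤ d, b i = a i) → ∀ (N : ℕ) (h : MvPolynomial (Fin 2) ℂ),
      X ^ (d + 1) ∣ branchEval N k h (truncatedSeries b (n + k) : ℂ⟦X⟧) X -
        branchEval N k h (mk a) X :=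
    fun b hb N h => (X_pow_dvd_truncatedSeries_sub (by omega) hb).trans
      (sub_dvd_branchEval_sub _ _ _ _ _)
  obtain ⟨e, f⟩ := expansion_of_X_pow_dvd (m := 0) (Nat.zero_le n) hd hd₂ hd₁ (key a' ha' _ _)
    (key a' ha' _ _)
  obtain ⟨e', f'⟩ := expansion_of_X_pow_dvd (m := 0) (Nat.zero_le n) hd hd₂ hd₁
    (key a (fun _ _ => rfl) _ _) (key a (fun _ _ => rfl) _ _)
  refine ⟨by omega, ?_⟩
  rw [f 0 (Nat.zero_le _) (Nat.zero_le _), f' 0 (Nat.zero_le _) (Nat.zero_le _)]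
  simp [coeff_eq_of_X_pow_dvd_sub (key a' ha' _ _) (Nat.lt_succ_self d),
    coeff_eq_of_X_pow_dvd_sub (key a (fun _ _ => rfl) _ _) (Nat.lt_succ_self d)]

/-- The polynomial `c₀ + c₁ u + ⋯ + c_N u ^ N` over an arbitrary ring. -/
noncomputable def seriesOfFin {R : Type*} [CommRing R] (N : ℕ) (c : Fin (N + 1) → R) :
    Polynomial R :=
  ∑ i, Polynomial.C (c i) * Polynomial.X ^ (i : ℕ)

/-- Computing with indeterminate coefficients and specializing afterwards exhibits the coefficients
of `P` and `Q` as polynomials in the `aᵢ`. -/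
theorem map_coeff_branchEval_seriesOfFin {R R' : Type*} [CommRing R] [Algebra ℂ R] [CommRing R']
    [Algebra ℂ R'] (φ : R →ₐ[ℂ] R') (N k : ℕ) (h : MvPolynomial (Fin 2) ℂ) (M : ℕ)
    (c : Fin (M + 1) → R) (a : ℕ → ℂ) (hc : ∀ i, φ (c i) = algebraMap ℂ R' (a i)) (i : ℕ) :
    φ ((branchEval N k h (seriesOfFin M c) Polynomial.X).coeff i) =
      algebraMap ℂ R' (coeff i (branchEval N k h (truncatedSeries a M : ℂ⟦X⟧) X)) := by
  rw [map_coeff_branchEval, ← coeff_branchEval_coe, ← Algebra.ofId_apply,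
    map_coeff_branchEval]
  congr 2
  simp only [seriesOfFin, truncatedSeries, Polynomial.map_sum, Polynomial.map_mul,
    Polynomial.map_C, Polynomial.map_pow, Polynomial.map_X, Finset.sum_range]
  refine Finset.sum_congr rfl fun i _ => ?_
  congr 2
  exact hc i

theorem forall_sum_eq_zero_iff {p : ℕ → ℂ} (hp : p d ≠ 0) (c b : ℕ → ℂ) (M : ℕ) :
    (∀ j ≤ M, ∑ i ∈ Finset.range (j + 1), c i * p (d + j - i) -
      ∑ i ∈ Finset.range (j + 1), b i * p (d + j - i) = 0) ↔ ∀ j ≤ M, c j = b j := by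
  constructor
  · intro h j
    induction j using Nat.strong_induction_on with
    | _ j ih =>
      intro hj
      have := h j hj
      rw [Finset.sum_range_succ, Finset.sum_range_succ, Finset.sum_congr rfl
        fun i hi => by rw [ih i (Finset.mem_range.1 hi) ((Finset.mem_range.1 hi).le.trans hj)],
        add_sub_add_left_eq_sub, Nat.add_sub_cancel, ← sub_mul] at this
      exact sub_eq_zero.1 ((mul_eq_zero.1 this).resolve_right hp)
  · intro h j hj
    rw [sub_eq_zero]
    refine Finset.sum_congr rfl fun i hi => ?_
    rw [h i ((Nat.lt_succ_iff.1 (Finset.mem_range.1 hi)).trans hj)]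

theorem coeff_mul_of_order {p : ℂ⟦X⟧} (hp : ∀ i < d, coeff i p = 0) (b : ℕ → ℂ) (j : ℕ) :
    coeff (d + j) (mk b * p) = ∑ i ∈ Finset.range (j + 1), b i * coeff (d + j - i) p := by
  rw [coeff_mul, Finset.Nat.sum_antidiagonal_eq_sum_range_succ_mk,
    ← Finset.sum_subset (s₁ := Finset.range (j + 1)) (Finset.range_mono (by omega))]
  · simp only [coeff_mk]
  · intro i hi hi'
    rw [Finset.mem_range] at hi hi'
    rw [hp _ (by omega), mul_zero]

/-- The expansion coefficients, computed from formal series. -/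
theorem expansion_of_formal_identity (b : ℕ → ℂ) (hD : 0 < D)
    (hne : branchEval (D - 1) k h₂ (mk a) X ≠ 0)
    (hb : branchEval D k h₁ (mk a) X = mk b * branchEval (D - 1) k h₂ (mk a) X) :
    (∃ r : ℕ, LeadingTermDeterminedUpTo (liftPolynomial h₁ h₂) k a r) ∧
      ∀ r : ℕ, LeadingTermDeterminedUpTo (liftPolynomial h₁ h₂) k a r →
        (∀ m : ℕ, ∀ᶠ n in Filter.atTop,
          r + m ≤ n ∧ m + k ≤ expansionDegree (liftPolynomial h₁ h₂) k a n m) ∧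
        ∃ (ρ : MvPolynomial (Fin (r + 1)) ℂ)
          (ρ' : (j : ℕ) → MvPolynomial (Fin (r + j + 1) ⊕ Fin j) ℂ),
          MvPolynomial.eval (fun i : Fin (r + 1) => a i) ρ ≠ 0 ∧
          ∀ m n : ℕ, r + m ≤ n →
            m + k ≤ expansionDegree (liftPolynomial h₁ h₂) k a n m →
            (∀ a' : ℕ → ℂ, (∀ i ≤ r, a' i = a i) →
              expansionDegree (liftPolynomial h₁ h₂) k a' n m =
                expansionDegree (liftPolynomial h₁ h₂) k a n m ∧
              ∀ j ≤ m + k,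
                expansionCoeff (liftPolynomial h₁ h₂) k a' n m j =
                  MvPolynomial.X j *
                      MvPolynomial.C (MvPolynomial.eval (fun i : Fin (r + 1) => a' i) ρ) -
                    MvPolynomial.aeval
                      (Sum.elim (fun i : Fin (r + j + 1) => MvPolynomial.C (a' i))
                        (fun i : Fin j => (MvPolynomial.X (i : ℕ) : MvPolynomial ℕ ℂ)))
                      (ρ' j)) ∧
            ∀ c : ℕ → ℂ,
              (∀ j ≤ m + k,
                MvPolynomial.eval c (expansionCoeff (liftPolynomial h₁ h₂) k a n m j) = 0) ↔
              ∀ j ≤ m + k, c j = b j := by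
  obtain ⟨d, hd, hd₂⟩ := exists_order_data hne
  have hd₁ : ∀ i < d, coeff i (branchEval D k h₁ (mk a) X) = 0 := by
    have : X ^ d ∣ branchEval D k h₁ (mk a) X := by
      rw [hb]
      exact dvd_mul_of_dvd_right (X_pow_dvd_iff.2 hd₂) _
    exact X_pow_dvd_iff.1 this
  refine ⟨⟨d, exists_leadingTermDeterminedUpTo hd hd₂ hd₁⟩, fun r hr => ?_⟩
  have H₂ := fun c => (perturbation_of_leadingTermDetermined hd hd₂ hd₁ hr c).1
  have H₁ := fun c => (perturbation_of_leadingTermDetermined hd hd₂ hd₁ hr c).2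
  have main : ∀ (a' : ℕ → ℂ), (∀ i ≤ r, a' i = a i) → ∀ m n : ℕ, r + m ≤ n →
      expansionDegree (liftPolynomial h₁ h₂) k a' n m + d = D * (n + k) ∧
      ∀ j ≤ m + k, j ≤ expansionDegree (liftPolynomial h₁ h₂) k a' n m →
        expansionCoeff (liftPolynomial h₁ h₂) k a' n m j =
          ∑ i ∈ Finset.range (j + 1), MvPolynomial.X i * MvPolynomial.C
            (coeff (d + j - i) (branchEval (D - 1) k h₂ (truncatedSeries a' (n + k) : ℂ⟦X⟧) X)) -
          MvPolynomial.C
            (coeff (d + j) (branchEval D k h₁ (truncatedSeries a' (n + k) : ℂ⟦X⟧) X)) := by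
    intro a' ha' m n hn
    have h := X_pow_dvd_truncatedSeries_sub (N := n + k) (by omega) ha'
    exact expansion_of_X_pow_dvd (by omega) hd hd₂ hd₁
      (X_pow_dvd_branchEval_sub _ _ _ _ r d 0 H₂ h h)
      (X_pow_dvd_branchEval_sub _ _ _ _ r d 0 H₁ h h)
  have key₂ : ∀ (j : ℕ) (y z : ℂ⟦X⟧), X ^ (r + 1) ∣ y - mk a → X ^ (r + 1 + j) ∣ y - z →
      ∀ i ≤ d + j, coeff i (branchEval (D - 1) k h₂ y X) =
        coeff i (branchEval (D - 1) k h₂ z X) := fun j y z hy hyz i hi =>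
    coeff_eq_of_X_pow_dvd_sub (X_pow_dvd_branchEval_sub _ _ _ _ r d j H₂ hy hyz) (by omega)
  have key₁ : ∀ (j : ℕ) (y z : ℂ⟦X⟧), X ^ (r + 1) ∣ y - mk a → X ^ (r + 1 + j) ∣ y - z →
      ∀ i ≤ d + j, coeff i (branchEval D k h₁ y X) =
        coeff i (branchEval D k h₁ z X) := fun j y z hy hyz i hi =>
    coeff_eq_of_X_pow_dvd_sub (X_pow_dvd_branchEval_sub _ _ _ _ r d j H₁ hy hyz) (by omega)
  have hρ : ∀ a' : ℕ → ℂ, (∀ i ≤ r, a' i = a i) →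
      MvPolynomial.eval (fun i : Fin (r + 1) => a' i) ((branchEval (D - 1) k h₂
        (seriesOfFin r MvPolynomial.X) Polynomial.X).coeff d) =
      coeff d (branchEval (D - 1) k h₂ (mk a) X) := by
    intro a' ha'
    have h := map_coeff_branchEval_seriesOfFin
      (MvPolynomial.aeval fun i : Fin (r + 1) => a' i) (D - 1) k h₂ r MvPolynomial.X a'
      (fun i => by simp) d
    rw [Algebra.algebraMap_self, RingHom.id_apply] at h
    have hx := X_pow_dvd_truncatedSeries_sub le_rfl ha'
    exact h.trans (key₂ 0 _ _ hx hx d le_rfl)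
  -- Witnesses: `ρ` is `P_d` for the generic series cut at order `r`, and `ρ_j` is `Q_{d+j} - ∑_{i <
  -- j} bᵢ P_{d+j-i}` for the generic series cut at order `r + j`.
  refine ⟨fun m => ?_, (branchEval (D - 1) k h₂ (seriesOfFin r MvPolynomial.X)
      Polynomial.X).coeff d, fun j =>
      (branchEval D k h₁ (seriesOfFin (r + j) fun i => MvPolynomial.X (Sum.inl i))
        Polynomial.X).coeff (d + j) -
      ∑ i : Fin j, MvPolynomial.X (Sum.inr i) * (branchEval (D - 1) k h₂
        (seriesOfFin (r + j) fun i => MvPolynomial.X (Sum.inl i)) Polynomial.X).coeff (d + j - i),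
      ?_, ?_⟩
  -- As `D ≥ 1`, one has `μ = D (n+k) - d ≥ n + k - d ≥ m + k`.
  · filter_upwards [Filter.eventually_ge_atTop (r + m + d)] with n hn
    have := (main a (fun _ _ => rfl) m n (by omega)).1
    have h' := Nat.mul_le_mul_right (n + k) hD
    omega
  · rwa [hρ a fun _ _ => rfl]
  intro m n hn hm
  have hdeg := (main a (fun _ _ => rfl) m n hn).1
  refine ⟨fun a' ha' => ?_, fun c => ?_⟩
  · obtain ⟨hdeg', hcoeff⟩ := main a' ha' m n hn
    refine ⟨by omega, fun j hj => ?_⟩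
    have hx : X ^ (r + 1) ∣ (truncatedSeries a' (n + k) : ℂ⟦X⟧) - mk a :=
      X_pow_dvd_truncatedSeries_sub (by omega) ha'
    -- Both truncations reach index `r + j`, because `j ≤ m + k` and `r + m ≤ n` give `r + j ≤ n +
    -- k`.
    have hxz : X ^ (r + 1 + j) ∣
        (truncatedSeries a' (n + k) : ℂ⟦X⟧) - (truncatedSeries a' (r + j) : ℂ⟦X⟧) :=
      X_pow_dvd_sub_of_coeff_eq fun i hi => by
        rw [coeff_coe_truncatedSeries, coeff_coe_truncatedSeries, if_pos (by omega),
          if_pos (by omega)]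
    rw [hcoeff j hj (by omega), map_sub, map_sum, hρ a' ha',
      map_coeff_branchEval_seriesOfFin _ _ _ _ _ _ a' (fun i => by simp),
      ← key₁ j _ _ hx hxz _ le_rfl, Finset.sum_range_succ, Nat.add_sub_cancel,
      key₂ 0 _ _ hx hx d le_rfl, Finset.sum_range]
    have hsum : ∀ i : Fin j, MvPolynomial.aeval
        (Sum.elim (fun i : Fin (r + j + 1) => MvPolynomial.C (a' i))
          (fun i : Fin j => (MvPolynomial.X (i : ℕ) : MvPolynomial ℕ ℂ)))
        ((MvPolynomial.X (Sum.inr i) : MvPolynomial (Fin (r + j + 1) ⊕ Fin j) ℂ) *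
          (branchEval (D - 1) k h₂ (seriesOfFin (r + j) fun i => MvPolynomial.X (Sum.inl i))
            Polynomial.X).coeff (d + j - i)) =
        MvPolynomial.X (i : ℕ) * MvPolynomial.C (coeff (d + j - i)
          (branchEval (D - 1) k h₂ (truncatedSeries a' (n + k) : ℂ⟦X⟧) X)) := by
      intro i
      rw [map_mul, MvPolynomial.aeval_X, Sum.elim_inr,
        map_coeff_branchEval_seriesOfFin _ _ _ _ _ _ a' (fun i => by simp),
        ← key₂ j _ _ hx hxz _ (by omega)]
      rfl
    rw [Finset.sum_congr rfl fun i _ => hsum i, MvPolynomial.algebraMap_eq]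
    ring
  -- With `Q = β P`, the value of `Λ_j` at `c` is `∑_{i ≤ j} (cᵢ - bᵢ) P_{d+j-i}`, a triangular
  -- system with diagonal entry `P_d`.
  · rw [← forall_sum_eq_zero_iff (p := fun i => coeff i (branchEval (D - 1) k h₂ (mk a) X)) hd c b]
    refine forall₂_congr fun j hj => ?_
    have hx : X ^ (r + 1) ∣ (truncatedSeries a (n + k) : ℂ⟦X⟧) - mk a :=
      X_pow_dvd_truncatedSeries_sub (by omega) fun _ _ => rfl
    have hxz : X ^ (r + 1 + j) ∣ (truncatedSeries a (n + k) : ℂ⟦X⟧) - mk a :=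
      (pow_dvd_pow _ (by omega)).trans (truncatedSeries_sub_mk a (n + k))
    rw [(main a (fun _ _ => rfl) m n hn).2 j hj (by omega), key₁ j _ _ hx hxz _ le_rfl, hb,
      coeff_mul_of_order hd₂, map_sub, map_sum, MvPolynomial.eval_C]
    refine Eq.congr_left (congrArg₂ _ (Finset.sum_congr rfl fun i hi => ?_) rfl)
    rw [map_mul, MvPolynomial.eval_X, MvPolynomial.eval_C, key₂ j _ _ hx hxz _ (by omega)]

end formal

/-! ### Growth at infinity and removable singularities. -/

/-- Otherwise points of `S` with `‖p‖ > N (1 + ‖p₀‖)`, scaled to norm one, accumulate at a unit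
vector that is a point at infinity with first coordinate zero. -/
theorem exists_norm_le_of_isPointAtInfinity {S : Set (Fin 3 → ℂ)}
    (hinf : ∀ x : Fin 3 → ℂ, IsPointAtInfinity S x → x 0 ≠ 0) :
    ∃ K : ℝ, 0 ≤ K ∧ ∀ p ∈ S, ‖p‖ ≤ K * (1 + ‖p 0‖) := by
  by_contra! hcon
  have hex : ∀ N : ℕ, ∃ p ∈ S, (N : ℝ) * (1 + ‖p 0‖) < ‖p‖ := fun N => hcon N N.cast_nonneg
  choose p hpS hp using hex
  have hpos : ∀ N, 0 < ‖p N‖ := fun N => lt_of_le_of_lt (by positivity) (hp N)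
  -- The scaling factor is also the last homogeneous coordinate of `(p : 1) = (s p : s)`, and it
  -- tends to zero.
  set s : ℕ → ℂ := fun N => ((‖p N‖⁻¹ : ℝ) : ℂ) with hs
  have hs_norm : ∀ N, ‖s N‖ = ‖p N‖⁻¹ := fun N => by simp [hs]
  have hvmem : ∀ N, s N • p N ∈ Metric.sphere (0 : Fin 3 → ℂ) 1 := fun N => by
    rw [mem_sphere_zero_iff_norm, norm_smul, hs_norm, inv_mul_cancel₀ (hpos N).ne']
  obtain ⟨v, hv, φ, hφ, hlim⟩ := (isCompact_sphere (0 : Fin 3 → ℂ) 1).tendsto_subseq hvmem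
  have hinv : Filter.Tendsto (fun N : ℕ => (N : ℝ)⁻¹) Filter.atTop (nhds 0) :=
    tendsto_inv_atTop_nhds_zero_nat
  have hs0 : Filter.Tendsto s Filter.atTop (nhds 0) := by
    refine squeeze_zero_norm' ?_ hinv
    filter_upwards [Filter.eventually_gt_atTop 0] with N hN
    have hN' : (0 : ℝ) < N := by exact_mod_cast hN
    rw [hs_norm]
    refine inv_anti₀ hN' ((le_mul_of_one_le_right hN'.le ?_).trans (hp N).le)
    linarith [norm_nonneg (p N 0)]
  have hv00 : Filter.Tendsto (fun N => (s N • p N) 0) Filter.atTop (nhds 0) := by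
    refine squeeze_zero_norm' ?_ hinv
    filter_upwards [Filter.eventually_gt_atTop 0] with N hN
    have hN' : (0 : ℝ) < N := by exact_mod_cast hN
    rw [Pi.smul_apply, norm_smul, hs_norm, inv_mul_le_iff₀ (hpos N), ← div_eq_mul_inv,
      le_div_iff₀ hN']
    nlinarith [hp N, norm_nonneg (p N 0)]
  have hv0 : v 0 = 0 :=
    tendsto_nhds_unique ((continuous_apply 0).continuousAt.tendsto.comp hlim)
      (hv00.comp hφ.tendsto_atTop)
  refine hinf v ⟨?_, fun f hf => ?_⟩ hv0
  · rintro rfl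
    simp at hv
  have hzero : ∀ N, MvPolynomial.eval (Fin.snoc (α := fun _ => ℂ) (s N • p N) (s N))
      (homogenization f) = 0 := by
    intro N
    have h := aeval_homogenization (Fin.snoc (α := fun _ => ℂ) (s N • p N) (s N)) f
    simp only [Fin.snoc_castSucc, Fin.snoc_last, Pi.smul_apply, smul_eq_mul] at h
    rw [homEval_smul _ _ _ _ le_rfl, hf (p N) (hpS N), mul_zero] at h
    exact h
  have hcont : Filter.Tendsto (fun N => Fin.snoc (α := fun _ => ℂ) (s (φ N) • p (φ N)) (s (φ N)))
      Filter.atTop (nhds (Fin.snoc (α := fun _ => ℂ) v 0)) := by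
    refine tendsto_pi_nhds.2 fun i => ?_
    refine Fin.lastCases ?_ (fun i => ?_) i
    · simpa only [Fin.snoc_last, Function.comp_def] using hs0.comp hφ.tendsto_atTop
    · simpa using (tendsto_pi_nhds.1 hlim) i
  refine tendsto_nhds_unique
    (((MvPolynomial.continuous_eval (homogenization f)).tendsto _).comp hcont) ?_
  simp only [Function.comp_def, hzero]
  exact tendsto_const_nhds

open Filter Topology in
/-- A quotient of holomorphic functions that is locally bounded is holomorphic. -/
theorem exists_differentiableOn_eq_mul {f g : ℂ → ℂ} {U : Set ℂ} (hU : IsOpen U)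
    (hf : DifferentiableOn ℂ f U) (hg : DifferentiableOn ℂ g U) (K : ℝ)
    (hb : ∀ z₀ ∈ U, ∀ᶠ z in 𝓝[≠] z₀, g z ≠ 0 ∧ ‖f z‖ ≤ K * ‖g z‖) :
    ∃ h : ℂ → ℂ, DifferentiableOn ℂ h U ∧ ∀ z ∈ U, f z = h z * g z := by
  -- Taking the punctured limit at every point avoids a case split: it is the quotient where `g ≠ 0`
  -- and the removable value elsewhere.
  set h : ℂ → ℂ := fun z => limUnder (𝓝[≠] z) fun w => f w / g w with hh
  have hdiff : DifferentiableOn ℂ h U := by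
    intro z₀ hz₀
    have hev : ∀ᶠ z in 𝓝 z₀, z ∈ U ∧ (z ≠ z₀ → g z ≠ 0 ∧ ‖f z‖ ≤ K * ‖g z‖) :=
      Filter.Eventually.and (hU.mem_nhds hz₀) (eventually_nhdsWithin_iff.1 (hb z₀ hz₀))
    obtain ⟨s, hs, hso, hzs⟩ := eventually_nhds_iff.1 hev
    have hd : DifferentiableOn ℂ (fun w => f w / g w) (s \ {z₀}) :=
      (hf.mono fun z hz => (hs z hz.1).1).div (hg.mono fun z hz => (hs z hz.1).1)
        fun z hz => ((hs z hz.1).2 hz.2).1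
    have hbd : BddAbove (norm ∘ (fun w => f w / g w) '' (s \ {z₀})) := by
      refine ⟨K, ?_⟩
      rintro _ ⟨z, hz, rfl⟩
      obtain ⟨h1, h2⟩ := (hs z hz.1).2 hz.2
      rw [Function.comp_apply, norm_div]
      exact (div_le_iff₀ (norm_pos_iff.2 h1)).2 h2
    have := Complex.differentiableOn_update_limUnder_of_bddAbove (hso.mem_nhds hzs) hd hbd
    refine ((this.congr fun z hz => ?_).differentiableAt
      (hso.mem_nhds hzs)).differentiableWithinAt
    rcases eq_or_ne z z₀ with rfl | hne
    · rw [Function.update_self]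
    · rw [Function.update_of_ne hne]
      have hc : ContinuousAt (fun w => f w / g w) z :=
        (hd.differentiableAt ((hso.sdiff isClosed_singleton).mem_nhds ⟨hz, hne⟩)).continuousAt
      exact (hc.tendsto.mono_left nhdsWithin_le_nhds).limUnder_eq
  refine ⟨h, hdiff, fun z₀ hz₀ => ?_⟩
  have hcf := (hf.differentiableAt (hU.mem_nhds hz₀)).continuousAt
  have hcg := (hg.differentiableAt (hU.mem_nhds hz₀)).continuousAt
  have hch := (hdiff.differentiableAt (hU.mem_nhds hz₀)).continuousAt
  refine tendsto_nhds_unique (hcf.tendsto.mono_left (nhdsWithin_le_nhds (s := {z₀}ᶜ)))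
    (Tendsto.congr' ?_ ((hch.mul hcg).tendsto.mono_left nhdsWithin_le_nhds))
  filter_upwards [hb z₀ hz₀, nhdsWithin_le_nhds (hU.mem_nhds hz₀)] with z hz hzU
  have hc : ContinuousAt (fun w => f w / g w) z :=
    ((hf.differentiableAt (hU.mem_nhds hzU)).div (hg.differentiableAt (hU.mem_nhds hzU))
      hz.1).continuousAt
  have : h z = f z / g z := (hc.tendsto.mono_left nhdsWithin_le_nhds).limUnder_eq
  rw [Pi.mul_apply, this, div_mul_cancel₀ _ hz.1]

/-! ### Power series converging on a disk and their sums. -/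

section convergent

open PowerSeries

/-- The power series that converge on the disk of radius `R`. -/
noncomputable def convergentSeries (R : ℝ) : Subalgebra ℂ ℂ⟦X⟧ where
  carrier := {f | ∀ u : ℂ, ‖u‖ < R → Summable fun n => coeff n f * u ^ n}
  mul_mem' {f g} hf hg u hu := by
    have := (summable_norm_sum_mul_antidiagonal_of_summable_norm (hf u hu).norm
      (hg u hu).norm).of_norm
    refine this.congr fun n => ?_
    rw [coeff_mul, Finset.sum_mul]
    refine Finset.sum_congr rfl fun x hx => ?_
    rw [← Finset.HasAntidiagonal.mem_antidiagonal.1 hx, pow_add]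
    ring
  add_mem' {f g} hf hg u hu := by
    refine ((hf u hu).add (hg u hu)).congr fun n => ?_
    rw [map_add, add_mul]
  algebraMap_mem' c u _ := by
    refine summable_of_ne_finset_zero (s := {0}) fun n hn => ?_
    rw [Finset.mem_singleton] at hn
    rw [PowerSeries.algebraMap_apply, Algebra.algebraMap_self, RingHom.id_apply, coeff_C, if_neg hn, zero_mul]

theorem X_mem_convergentSeries (R : ℝ) : (X : ℂ⟦X⟧) ∈ convergentSeries R := fun u _ => by
  refine summable_of_ne_finset_zero (s := {1}) fun n hn => ?_
  rw [Finset.mem_singleton] at hn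
  rw [coeff_X, if_neg hn, zero_mul]

/-- The sum of a power series at a point. -/
noncomputable def seriesSum (f : ℂ⟦X⟧) (u : ℂ) : ℂ := ∑' n, coeff n f * u ^ n

theorem seriesSum_mul {R : ℝ} {f g : ℂ⟦X⟧} (hf : f ∈ convergentSeries R)
    (hg : g ∈ convergentSeries R) {u : ℂ} (hu : ‖u‖ < R) :
    seriesSum (f * g) u = seriesSum f u * seriesSum g u := by
  simp only [seriesSum]
  rw [tsum_mul_tsum_eq_tsum_sum_antidiagonal_of_summable_norm (hf u hu).norm (hg u hu).norm]
  refine tsum_congr fun n => ?_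
  rw [coeff_mul, Finset.sum_mul]
  refine Finset.sum_congr rfl fun x hx => ?_
  rw [← Finset.HasAntidiagonal.mem_antidiagonal.1 hx, pow_add]
  ring

theorem seriesSum_sub {R : ℝ} {f g : ℂ⟦X⟧} (hf : f ∈ convergentSeries R)
    (hg : g ∈ convergentSeries R) {u : ℂ} (hu : ‖u‖ < R) :
    seriesSum (f - g) u = seriesSum f u - seriesSum g u := by
  simp only [seriesSum]
  rw [← (hf u hu).tsum_sub (hg u hu)]
  refine tsum_congr fun n => ?_
  rw [map_sub, sub_mul]

/-- Evaluation of convergent power series at a point of the disk. -/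
noncomputable def convergentSeriesEval {R : ℝ} {u : ℂ} (hu : ‖u‖ < R) :
    convergentSeries R →ₐ[ℂ] ℂ where
  toFun f := seriesSum f u
  map_one' := by
    rw [seriesSum, tsum_eq_single 0 fun n hn => by
      rw [OneMemClass.coe_one, coeff_one, if_neg hn, zero_mul]]
    simp
  map_zero' := by simp [seriesSum]
  map_mul' f g := seriesSum_mul f.2 g.2 hu
  map_add' f g := by
    simp only [seriesSum]
    rw [← (f.2 u hu).tsum_add (g.2 u hu)]
    refine tsum_congr fun n => ?_
    rw [AddMemClass.coe_add, map_add, add_mul]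
  commutes' c := by
    rw [seriesSum, tsum_eq_single 0 fun n hn => by
      rw [Subalgebra.coe_algebraMap, PowerSeries.algebraMap_apply, Algebra.algebraMap_self, RingHom.id_apply,
        coeff_C, if_neg hn, zero_mul]]
    simp

theorem seriesSum_X (u : ℂ) : seriesSum X u = u := by
  rw [seriesSum, tsum_eq_single 1 fun n hn => by rw [coeff_X, if_neg hn, zero_mul]]
  simp

theorem branchEval_mem_convergentSeries {R : ℝ} {f : ℂ⟦X⟧} (hf : f ∈ convergentSeries R)
    (N k : ℕ) (h : MvPolynomial (Fin 2) ℂ) :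
    branchEval N k h f X ∈ convergentSeries R := by
  have := map_branchEval (convergentSeries R).val N k h ⟨f, hf⟩ ⟨X, X_mem_convergentSeries R⟩
  simp only [Subalgebra.val_apply] at this
  rw [← this]
  exact Subtype.property _

theorem seriesSum_branchEval {R : ℝ} {f : ℂ⟦X⟧} (hf : f ∈ convergentSeries R)
    (N k : ℕ) (h : MvPolynomial (Fin 2) ℂ) {u : ℂ} (hu : ‖u‖ < R) :
    seriesSum (branchEval N k h f X) u = branchEval N k h (seriesSum f u) u := by
  have h1 := map_branchEval (convergentSeries R).val N k h ⟨f, hf⟩ ⟨X, X_mem_convergentSeries R⟩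
  have h2 := map_branchEval (convergentSeriesEval hu) N k h ⟨f, hf⟩
    ⟨X, X_mem_convergentSeries R⟩
  simp only [Subalgebra.val_apply] at h1
  rw [← h1]
  refine Eq.trans h2 ?_
  congr 1
  exact seriesSum_X u

theorem eq_zero_of_seriesSum_eq_zero {R : ℝ} (hR : 0 < R) {f : ℂ⟦X⟧} (hf : f ∈ convergentSeries R)
    (h : ∀ u : ℂ, u ≠ 0 → ‖u‖ < R → seriesSum f u = 0) : f = 0 := by
  -- Nothing is assumed at `u = 0`; multiplication by `X` makes the sum vanish there too.
  have hXf : X * f ∈ convergentSeries R := mul_mem (X_mem_convergentSeries R) hf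
  suffices hX : X * f = 0 from (mul_eq_zero.1 hX).resolve_left X_ne_zero
  have hps : HasFPowerSeriesAt (0 : ℂ → ℂ)
      (FormalMultilinearSeries.ofScalars ℂ fun n => coeff n (X * f)) 0 := by
    rw [hasFPowerSeriesAt_iff]
    filter_upwards [Metric.ball_mem_nhds (0 : ℂ) hR] with u hu
    rw [mem_ball_zero_iff] at hu
    have hz : seriesSum (X * f) u = 0 := by
      rw [seriesSum_mul (X_mem_convergentSeries R) hf hu, seriesSum_X]
      rcases eq_or_ne u 0 with rfl | hne
      · rw [zero_mul]
      · rw [h u hne hu, mul_zero]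
    have := (hXf u hu).hasSum
    rw [show ∑' n, coeff n (X * f) * u ^ n = 0 from hz] at this
    simpa [FormalMultilinearSeries.coeff_ofScalars, mul_comm] using this
  ext n
  rw [← FormalMultilinearSeries.coeff_ofScalars (𝕜 := ℂ) (p := fun n => coeff n (X * f)),
    hps.eq_zero]
  rfl

theorem differentiableOn_seriesSum {R : ℝ} {f : ℂ⟦X⟧} (hf : f ∈ convergentSeries R) :
    DifferentiableOn ℂ (seriesSum f) (Metric.ball 0 R) := by
  intro u hu
  rw [mem_ball_zero_iff] at hu
  obtain ⟨r, hur, hrR⟩ := exists_between hu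
  have hr : 0 < r := (norm_nonneg u).trans_lt hur
  have hsum := (hf (r : ℂ) (by simpa [abs_of_pos hr] using hrR)).norm
  refine (DifferentiableOn.differentiableAt (s := Metric.ball 0 r) ?_
    (Metric.isOpen_ball.mem_nhds (by simpa using hur))).differentiableWithinAt
  refine Complex.differentiableOn_tsum_of_summable_norm hsum
    (fun n => ((differentiable_id.pow n).const_mul _).differentiableOn) Metric.isOpen_ball
    fun n w hw => ?_
  rw [mem_ball_zero_iff] at hw
  simp only [norm_mul, norm_pow, Complex.norm_real, Real.norm_eq_abs, abs_of_pos hr]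
  gcongr

theorem exists_convergentSeries_of_differentiableOn {R : ℝ} {h : ℂ → ℂ}
    (hh : DifferentiableOn ℂ h (Metric.ball 0 R)) :
    ∃ b : ℕ → ℂ, mk b ∈ convergentSeries R ∧ ∀ u : ℂ, ‖u‖ < R → seriesSum (mk b) u = h u := by
  have key : ∀ u : ℂ, ‖u‖ < R → HasSum
      (fun n => coeff n (mk fun n => (n.factorial : ℂ)⁻¹ * iteratedDeriv n h 0) * u ^ n)
      (h u) := by
    intro u hu
    have := Complex.hasSum_taylorSeries_on_ball hh (mem_ball_zero_iff.2 hu)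
    have e : (fun n => (n.factorial : ℂ)⁻¹ • (u - 0) ^ n • iteratedDeriv n h 0) =
        fun n => coeff n (mk fun n => (n.factorial : ℂ)⁻¹ * iteratedDeriv n h 0) * u ^ n := by
      funext n
      simp only [coeff_mk, smul_eq_mul, sub_zero]
      ring
    rwa [e] at this
  exact ⟨_, fun u hu => (key u hu).summable, fun u hu => (key u hu).tsum_eq⟩

end convergent

/-! ### Branches of an irreducible plane curve, in the coordinate `u = 1/w`. -/

/-- Through `f` the class of `x₂` is algebraic over `ℂ[x₁]`, hence so is every class modulo `I`. In
a domain, a nonzero algebraic element divides the image of some nonzero `p(x₁)`. -/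
theorem exists_mul_sub_aeval_mem {I : Ideal (MvPolynomial (Fin 2) ℂ)} (hI : I.IsPrime)
    {f h : MvPolynomial (Fin 2) ℂ} (hf : f ∈ I) (hf0 : f ≠ 0) (hh : h ∉ I) :
    ∃ p : Polynomial ℂ, p ≠ 0 ∧ ∃ g, Polynomial.aeval (MvPolynomial.X 0) p - h * g ∈ I := by
  let _ : Algebra (Polynomial ℂ) (MvPolynomial (Fin 2) ℂ ⧸ I) :=
    ((Ideal.Quotient.mk I).comp
      (Polynomial.aeval (R := ℂ) (MvPolynomial.X 0 : MvPolynomial (Fin 2) ℂ)).toRingHom).toAlgebra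
  have halg : ∀ p : Polynomial ℂ, algebraMap (Polynomial ℂ) (MvPolynomial (Fin 2) ℂ ⧸ I) p =
    Ideal.Quotient.mk I (Polynomial.aeval (MvPolynomial.X 0) p) := fun p => rfl
  set P : Polynomial (Polynomial ℂ) :=
    MvPolynomial.aeval ![Polynomial.C Polynomial.X, Polynomial.X] f with hP
  have hP0 : P ≠ 0 := by
    intro h0
    apply hf0
    have hcomp : ((Polynomial.eval₂RingHom
        (Polynomial.aeval (R := ℂ) (MvPolynomial.X 0 : MvPolynomial (Fin 2) ℂ)).toRingHom
        (MvPolynomial.X 1)).comp (MvPolynomial.aeval (R := ℂ)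
          (![Polynomial.C Polynomial.X, Polynomial.X] : Fin 2 → Polynomial (Polynomial ℂ))).toRingHom) = RingHom.id _ := by
      refine MvPolynomial.ringHom_ext (fun c => ?_) fun i => ?_
      · simp [Polynomial.algebraMap_apply]
      · fin_cases i <;> simp
    have := DFunLike.congr_fun hcomp f
    rw [RingHom.id_apply] at this
    rw [← this, RingHom.comp_apply]
    change Polynomial.eval₂RingHom _ _ P = 0
    rw [h0, map_zero]
  have hPy : Polynomial.aeval (Ideal.Quotient.mk I (MvPolynomial.X 1)) P = 0 := by
    have hcomp : ((Polynomial.aeval (R := Polynomial ℂ)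
        (Ideal.Quotient.mk I (MvPolynomial.X 1))).toRingHom.comp (MvPolynomial.aeval (R := ℂ)
          (![Polynomial.C Polynomial.X, Polynomial.X] : Fin 2 → Polynomial (Polynomial ℂ))).toRingHom) = Ideal.Quotient.mk I := by
      refine MvPolynomial.ringHom_ext (fun c => ?_) fun i => ?_
      · simp [Polynomial.algebraMap_apply, halg]
      · fin_cases i <;> simp [halg]
    have := DFunLike.congr_fun hcomp f
    rw [Ideal.Quotient.eq_zero_iff_mem.2 hf] at this
    exact this
  have hall : ∀ g : MvPolynomial (Fin 2) ℂ,
      IsAlgebraic (Polynomial ℂ) (Ideal.Quotient.mk I g) := by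
    intro g
    induction g using MvPolynomial.induction_on with
    | C c =>
      have : Ideal.Quotient.mk I (MvPolynomial.C c) =
          algebraMap (Polynomial ℂ) _ (Polynomial.C c) := by simp [halg]
      rw [this]
      exact isAlgebraic_algebraMap _
    | add p q hp hq =>
      rw [map_add]
      exact hp.add hq
    | mul_X p i hp =>
      rw [map_mul]
      refine hp.mul ?_
      fin_cases i
      · have : Ideal.Quotient.mk I (MvPolynomial.X 0) =
          algebraMap (Polynomial ℂ) _ Polynomial.X := by simp [halg]
        exact this ▸ isAlgebraic_algebraMap _
      · exact ⟨P, hP0, hPy⟩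
  obtain ⟨p, hp0, g, hg⟩ := (hall h).exists_nonzero_dvd
    (mem_nonZeroDivisors_of_ne_zero fun h0 => hh (Ideal.Quotient.eq_zero_iff_mem.1 h0))
  obtain ⟨g, rfl⟩ := Ideal.Quotient.mk_surjective g
  refine ⟨p, hp0, g, ?_⟩
  rw [← Ideal.Quotient.eq_zero_iff_mem, map_sub, map_mul, ← hg, halg, sub_self]

open PowerSeries in
theorem branchTerm_eq (k : ℕ) (a : ℕ → ℂ) {w : ℂ} (hw : w ≠ 0) (i : ℕ) :
    branchTerm k a w i = w ^ k * (coeff i (mk a) * w⁻¹ ^ i) := by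
  rw [branchTerm, zpow_sub₀ hw, zpow_natCast, zpow_natCast, coeff_mk, inv_pow]
  ring

theorem branchValue_eq (k : ℕ) (a : ℕ → ℂ) {w : ℂ} (hw : w ≠ 0) :
    branchValue k a w = w ^ k * seriesSum (PowerSeries.mk a) w⁻¹ := by
  rw [branchValue, seriesSum, ← tsum_mul_left]
  exact tsum_congr fun i => branchTerm_eq k a hw i

theorem summable_branchTerm_iff (k : ℕ) (a : ℕ → ℂ) {w : ℂ} (hw : w ≠ 0) :
    Summable (branchTerm k a w) ↔
      Summable fun i => PowerSeries.coeff i (PowerSeries.mk a) * w⁻¹ ^ i := by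
  rw [funext fun i => branchTerm_eq k a hw i]
  exact summable_mul_left_iff (pow_ne_zero k hw)

theorem exists_radius {k : ℕ} (hk : 0 < k) {M : ℝ} (hM : 0 < M) :
    ∃ R : ℝ, 0 < R ∧ ∀ w : ℂ, w ≠ 0 → (M < ‖w ^ k‖ ↔ ‖w⁻¹‖ < R) := by
  refine ⟨M⁻¹ ^ (k : ℝ)⁻¹, by positivity, fun w hw => ?_⟩
  have hw' : 0 < ‖w‖ := norm_pos_iff.2 hw
  rw [← pow_lt_pow_iff_left₀ (norm_nonneg _) (by positivity) hk.ne',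
    Real.rpow_inv_natCast_pow (by positivity) hk.ne', norm_inv, inv_pow, norm_pow,
    inv_lt_inv₀ (by positivity) hM]

theorem ne_zero_of_lt_norm_pow {k : ℕ} (hk : 0 < k) {M : ℝ} (hM : 0 < M) {w : ℂ}
    (h : M < ‖w ^ k‖) : w ≠ 0 := by
  rintro rfl
  rw [zero_pow hk.ne', norm_zero] at h
  exact hM.not_gt h

theorem mk_mem_convergentSeries {k : ℕ} {a : ℕ → ℂ} {M R : ℝ}
    (hR : ∀ w : ℂ, w ≠ 0 → (M < ‖w ^ k‖ ↔ ‖w⁻¹‖ < R))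
    (h : ∀ w : ℂ, M < ‖w ^ k‖ → Summable (branchTerm k a w)) :
    PowerSeries.mk a ∈ convergentSeries R := by
  intro u hu
  rcases eq_or_ne u 0 with rfl | hne
  · refine summable_of_ne_finset_zero (s := {0}) fun n hn => ?_
    rw [zero_pow (by simpa using hn), mul_zero]
  · have := (summable_branchTerm_iff k a (inv_ne_zero hne)).1
      (h _ ((hR _ (inv_ne_zero hne)).2 (by rwa [inv_inv])))
    rwa [inv_inv] at this

/-- Scaling `(u⁻ᵏ, u⁻ᵏ y, 1)` by `uᵏ` gives `(1, y, uᵏ)`. Thus values of `h` on the branch become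
values of `P` or `Q`. -/
theorem branchEval_eq (N k : ℕ) (h : MvPolynomial (Fin 2) ℂ) (hN : h.totalDegree ≤ N) (y : ℂ)
    {u : ℂ} (hu : u ≠ 0) :
    branchEval N k h y u = (u ^ k) ^ N * MvPolynomial.eval ![u⁻¹ ^ k, u⁻¹ ^ k * y] h := by
  have := homEval_smul N ![u⁻¹ ^ k, u⁻¹ ^ k * y] (u ^ k) h hN
  rw [branchEval]
  refine Eq.trans ?_ this
  congr 2
  have hk : u ^ k ≠ 0 := pow_ne_zero k hu
  funext i
  fin_cases i
  · simp [hk]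
  · simp [hk]

theorem isPrime_vanishingIdeal_image_projectAlongThird {S : Set (Fin 3 → ℂ)}
    (hS : (MvPolynomial.vanishingIdeal ℂ S).IsPrime) :
    (MvPolynomial.vanishingIdeal ℂ (projectAlongThird '' S)).IsPrime := by
  have : MvPolynomial.vanishingIdeal ℂ (projectAlongThird '' S) =
      (MvPolynomial.vanishingIdeal ℂ S).comap
        (MvPolynomial.rename (R := ℂ) (Fin.castSucc : Fin 2 → Fin 3)) := by
    ext p
    rw [Ideal.mem_comap, MvPolynomial.mem_vanishingIdeal_iff, MvPolynomial.mem_vanishingIdeal_iff,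
      Set.forall_mem_image]
    refine forall₂_congr fun x _ => ?_
    rw [MvPolynomial.aeval_rename]
    have hx : projectAlongThird x = x ∘ (Fin.castSucc : Fin 2 → Fin 3) := by
      funext i
      fin_cases i <;> rfl
    rw [hx]
  rw [this]
  exact hS.comap _

/-- A polynomial that does not vanish identically on an irreducible plane curve does not vanish
identically on any of its infinity branches. -/
theorem exists_eval_ne_zero_of_isPlaneInfinityBranch {I : Ideal (MvPolynomial (Fin 2) ℂ)}
    (hI : I.IsPrime) {f h : MvPolynomial (Fin 2) ℂ} (hf : f ∈ I) (hf0 : f ≠ 0) (hh : h ∉ I)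
    {k : ℕ} {a : ℕ → ℂ} {M : ℝ} (hB : IsPlaneInfinityBranch (MvPolynomial.zeroLocus ℂ I) k a M) :
    ∃ w : ℂ, M < ‖w ^ k‖ ∧ MvPolynomial.eval ![w ^ k, branchValue k a w] h ≠ 0 := by
  by_contra! hcon
  -- If `h` vanished on the branch, so would `p(x₁)`; but `x₁ = wᵏ` takes all the values `M + 1 +
  -- n`, too many roots for `p ≠ 0`.
  obtain ⟨p, hp0, g, hpg⟩ := exists_mul_sub_aeval_mem hI hf hf0 hh
  apply hp0
  refine Polynomial.eq_zero_of_infinite_isRoot p (Set.infinite_of_injective_forall_mem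
    (f := fun n : ℕ => (((M + 1 + n : ℝ)) : ℂ)) (fun m n hmn => ?_) fun n => ?_)
  · simpa using hmn
  obtain ⟨w, hw⟩ := IsAlgClosed.exists_pow_nat_eq (((M + 1 + n : ℝ)) : ℂ) hB.ramification_pos
  have hwM : M < ‖w ^ k‖ := by
    rw [hw, Complex.norm_real, Real.norm_eq_abs, abs_of_pos (by have := hB.radius_pos; positivity)]
    have : (0 : ℝ) ≤ n := n.cast_nonneg
    linarith
  have h0 : MvPolynomial.aeval ![w ^ k, branchValue k a w]
      (Polynomial.aeval (MvPolynomial.X 0) p - h * g) = (0 : ℂ) :=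
    hB.subset ⟨w, hwM, rfl⟩ _ hpg
  have hh0 : MvPolynomial.aeval ![w ^ k, branchValue k a w] h = (0 : ℂ) := hcon w hwM
  rw [map_sub, map_mul, hh0, zero_mul, sub_zero, ← Polynomial.aeval_algHom_apply,
    MvPolynomial.aeval_X, Polynomial.coe_aeval_eq_eval] at h0
  rw [Set.mem_ofPred_eq, Polynomial.IsRoot, ← hw]
  exact h0

/-! ### Lifting the plane branch to the space curve. -/

section lift

open PowerSeries

variable {f₁ f₂ : MvPolynomial (Fin 3) ℂ} {fp h₁ h₂ : MvPolynomial (Fin 2) ℂ} {k : ℕ}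
  {a : ℕ → ℂ} {M : ℝ}

local notation "D" => MvPolynomial.totalDegree (liftPolynomial h₁ h₂)

/-- This is where irreducibility enters: the ideal of the projection is prime and does not contain
`h₂`, so `h₂` is nonzero at some point of the branch. -/
theorem branchEval_mk_ne_zero (hC : IsIrreducibleCurve (spaceCurve f₁ f₂)) (hfp : fp ≠ 0)
    (hproj : planeCurve fp = zariskiClosure (projectAlongThird '' spaceCurve f₁ f₂))
    (hlift : IsLiftFunction (spaceCurve f₁ f₂) (planeCurve fp) h₁ h₂) (hh₂ : h₂ ≠ 0)
    (hB : IsPlaneInfinityBranch (planeCurve fp) k a M) :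
    branchEval (D - 1) k h₂ (mk a) X ≠ 0 := by
  intro h0
  set I := MvPolynomial.vanishingIdeal ℂ (projectAlongThird '' spaceCurve f₁ f₂) with hI
  have hproj' : planeCurve fp = MvPolynomial.zeroLocus ℂ I := hproj
  have hfI : fp ∈ I := fun x hx => by
    have : x ∈ planeCurve fp := hproj' ▸ fun p hp => hp x hx
    exact this
  have hhI : h₂ ∉ I := fun hmem => by
    obtain ⟨p, hp, hne⟩ := hlift.1
    exact hne ((hproj' ▸ hp : p ∈ MvPolynomial.zeroLocus ℂ I) _ hmem)
  obtain ⟨w, hw, hne⟩ := exists_eval_ne_zero_of_isPlaneInfinityBranch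
    (isPrime_vanishingIdeal_image_projectAlongThird hC.1) hfI hfp hhI (hproj' ▸ hB)
  obtain ⟨R, hR, hwR⟩ := exists_radius hB.ramification_pos hB.radius_pos
  have hw0 := ne_zero_of_lt_norm_pow hB.ramification_pos hB.radius_pos hw
  have ha := mk_mem_convergentSeries hwR hB.summable
  have hdeg := totalDegree_right_lt_liftPolynomial h₁ h₂ hh₂
  have := seriesSum_branchEval ha (D - 1) k h₂ ((hwR w hw0).1 hw)
  rw [h0, branchEval_eq _ _ _ (by omega) _ (inv_ne_zero hw0), inv_inv, ← branchValue_eq k a hw0,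
    show seriesSum (0 : ℂ⟦X⟧) w⁻¹ = 0 by simp [seriesSum]] at this
  rcases mul_eq_zero.1 this.symm with h | h
  · exact pow_ne_zero _ (pow_ne_zero _ (inv_ne_zero hw0)) h
  · exact hne h

/-- On a space branch over the plane branch, the third series is the quotient of the two series
that come from the lift function. -/
theorem branchEval_eq_mul_of_isSpaceInfinityBranch
    (hlift : IsLiftFunction (spaceCurve f₁ f₂) (planeCurve fp) h₁ h₂) (hh₂ : h₂ ≠ 0)
    (hne : branchEval (D - 1) k h₂ (mk a) X ≠ 0) {b : ℕ → ℂ}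
    (hB : IsSpaceInfinityBranch (spaceCurve f₁ f₂) k a b M) :
    branchEval D k h₁ (mk a) X = mk b * branchEval (D - 1) k h₂ (mk a) X := by
  obtain ⟨R, hR, hwR⟩ := exists_radius hB.ramification_pos hB.radius_pos
  have ha := mk_mem_convergentSeries hwR hB.summable₂
  have hb := mk_mem_convergentSeries hwR hB.summable₃
  have hdeg := totalDegree_right_lt_liftPolynomial h₁ h₂ hh₂
  have hdeg' := totalDegree_left_le_liftPolynomial h₁ h₂
  have hE₁ := branchEval_mem_convergentSeries ha D k h₁
  have hE₂ := branchEval_mem_convergentSeries ha (D - 1) k h₂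
  have hE := mul_mem hb hE₂
  rw [← sub_eq_zero]
  -- The difference `Q - β P` is multiplied by `P` so that points with `h₂ = 0`, where the lift
  -- function says nothing, are trivial.
  refine (mul_eq_zero.1 (eq_zero_of_seriesSum_eq_zero hR (mul_mem hE₂ (sub_mem hE₁ hE))
    fun u hu0 hu => ?_)).resolve_left hne
  rw [seriesSum_mul hE₂ (sub_mem hE₁ hE) hu, seriesSum_sub hE₁ hE hu, seriesSum_mul hb hE₂ hu,
    seriesSum_branchEval ha _ _ _ hu, seriesSum_branchEval ha _ _ _ hu,
    branchEval_eq _ _ _ hdeg' _ hu0, branchEval_eq _ _ _ (by omega : h₂.totalDegree ≤ D - 1) _ hu0]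
  have hmem : ![u⁻¹ ^ k, branchValue k a u⁻¹, branchValue k b u⁻¹] ∈ spaceCurve f₁ f₂ :=
    hB.subset ⟨u⁻¹, (hwR _ (inv_ne_zero hu0)).2 (by rwa [inv_inv]), rfl⟩
  rw [branchValue_eq _ _ (inv_ne_zero hu0), branchValue_eq _ _ (inv_ne_zero hu0), inv_inv] at hmem
  by_cases h0 : MvPolynomial.eval ![u⁻¹ ^ k, u⁻¹ ^ k * seriesSum (mk a) u] h₂ = 0
  · rw [h0]
    ring
  have h3 := ((hlift.2 _ _ _ h0).1 hmem).2
  rw [eq_div_iff h0] at h3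
  rw [← h3]
  have hk : u ^ k * u⁻¹ ^ k = 1 := by rw [← mul_pow, mul_inv_cancel₀ hu0, one_pow]
  obtain ⟨d, hd⟩ : ∃ d, D = d + 1 := ⟨D - 1, by omega⟩
  rw [hd, Nat.add_sub_cancel]
  refine mul_eq_zero_of_right _ ?_
  rw [pow_succ]
  linear_combination (u ^ k) ^ d * seriesSum (mk b) u *
    MvPolynomial.eval ![u⁻¹ ^ k, u⁻¹ ^ k * seriesSum (mk a) u] h₂ * hk

-- The quotient `A₁ / A₂` is bounded by the growth estimate, so it extends over the zeros of `A₂`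
-- and over `u = 0` without shrinking the disk. Branch points over zeros of `A₂` stay on the curve
-- because it is closed.
open Filter Topology in
theorem exists_isSpaceInfinityBranch
    (hinf : ∀ x : Fin 3 → ℂ, IsPointAtInfinity (spaceCurve f₁ f₂) x → x 0 ≠ 0)
    (hlift : IsLiftFunction (spaceCurve f₁ f₂) (planeCurve fp) h₁ h₂) (hh₂ : h₂ ≠ 0)
    (hne : branchEval (D - 1) k h₂ (mk a) X ≠ 0)
    (hB : IsPlaneInfinityBranch (planeCurve fp) k a M) :
    ∃ b : ℕ → ℂ, IsSpaceInfinityBranch (spaceCurve f₁ f₂) k a b M := by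
  obtain ⟨R, hR, hwR⟩ := exists_radius hB.ramification_pos hB.radius_pos
  have ha := mk_mem_convergentSeries hwR hB.summable
  have hdeg := totalDegree_right_lt_liftPolynomial h₁ h₂ hh₂
  have hdeg' := totalDegree_left_le_liftPolynomial h₁ h₂
  have hE₁ := branchEval_mem_convergentSeries ha D k h₁
  have hE₂ := branchEval_mem_convergentSeries ha (D - 1) k h₂
  set A₁ := seriesSum (branchEval D k h₁ (mk a) X) with hA₁
  set A₂ := seriesSum (branchEval (D - 1) k h₂ (mk a) X) with hA₂
  set α := seriesSum (mk a) with hα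
  have hd₁ : DifferentiableOn ℂ A₁ (Metric.ball 0 R) := differentiableOn_seriesSum hE₁
  have hd₂ : DifferentiableOn ℂ A₂ (Metric.ball 0 R) := differentiableOn_seriesSum hE₂
  have hlift' : ∀ u : ℂ, u ≠ 0 → ‖u‖ < R → A₂ u ≠ 0 →
      ![u⁻¹ ^ k, u⁻¹ ^ k * α u, u⁻¹ ^ k * (A₁ u / A₂ u)] ∈ spaceCurve f₁ f₂ := by
    intro u hu0 hu hA
    have e₁ := seriesSum_branchEval ha D k h₁ hu
    have e₂ := seriesSum_branchEval ha (D - 1) k h₂ hu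
    rw [branchEval_eq _ _ _ hdeg' _ hu0] at e₁
    rw [branchEval_eq _ _ _ (by omega : h₂.totalDegree ≤ D - 1) _ hu0] at e₂
    have hk0 : u ^ k ≠ 0 := pow_ne_zero k hu0
    have hev : MvPolynomial.eval ![u⁻¹ ^ k, u⁻¹ ^ k * α u] h₂ ≠ 0 := by
      intro h0
      exact hA (e₂.trans (by rw [h0, mul_zero]))
    refine (hlift.2 _ _ _ hev).2 ⟨hB.subset ⟨u⁻¹, (hwR _ (inv_ne_zero hu0)).2 (by rwa [inv_inv]),
      ?_⟩, ?_⟩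
    · rw [branchValue_eq _ _ (inv_ne_zero hu0), inv_inv]
    · rw [hA₁, hA₂, e₁, e₂]
      obtain ⟨d, hd⟩ : ∃ d, D = d + 1 := ⟨D - 1, by omega⟩
      rw [hd, Nat.add_sub_cancel, inv_pow]
      rw [inv_pow] at hev
      field_simp
      rw [hα, pow_succ']
  obtain ⟨K, hK0, hK⟩ := exists_norm_le_of_isPointAtInfinity hinf
  have hne' : ∀ z₀ ∈ Metric.ball (0 : ℂ) R, ∀ᶠ z in 𝓝[≠] z₀, A₂ z ≠ 0 := by
    intro z₀ hz₀
    have han := hd₂.analyticOnNhd Metric.isOpen_ball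
    by_contra hfreq
    have hfr : ∃ᶠ z in 𝓝[≠] z₀, A₂ z = 0 := hfreq
    have := han.eqOn_zero_of_preconnected_of_frequently_eq_zero
      (convex_ball (0 : ℂ) R).isPreconnected hz₀ hfr
    exact hne (eq_zero_of_seriesSum_eq_zero hR hE₂ fun u _ hu => this (mem_ball_zero_iff.2 hu))
  have hbound : ∀ u : ℂ, u ≠ 0 → ‖u‖ < R → A₂ u ≠ 0 →
      ‖A₁ u‖ ≤ K * (R ^ k + 1) * ‖A₂ u‖ := by
    intro u hu0 hu hA
    have h1 := hK _ (hlift' u hu0 hu hA)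
    have h2 := (norm_le_pi_norm ![u⁻¹ ^ k, u⁻¹ ^ k * α u, u⁻¹ ^ k * (A₁ u / A₂ u)] 2).trans h1
    have hu' : 0 < ‖u‖ ^ k := pow_pos (norm_pos_iff.2 hu0) k
    have hA' : 0 < ‖A₂ u‖ := norm_pos_iff.2 hA
    have h3 : ‖u⁻¹ ^ k * (A₁ u / A₂ u)‖ ≤ K * (1 + ‖u⁻¹ ^ k‖) := h2
    rw [norm_mul, norm_div, norm_pow, norm_inv, inv_pow, inv_mul_le_iff₀ hu', div_le_iff₀ hA'] at h3
    refine h3.trans (mul_le_mul_of_nonneg_right ?_ hA'.le)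
    -- Multiplication by `‖u‖ ^ k` cancels the pole in the growth bound, which gives the constant `K
    -- (R ^ k + 1)`.
    have h4 : ‖u‖ ^ k * (K * (1 + (‖u‖ ^ k)⁻¹)) = K * (‖u‖ ^ k + 1) := by
      field_simp
    rw [h4]
    gcongr
  obtain ⟨β, hβ, hβeq⟩ := exists_differentiableOn_eq_mul Metric.isOpen_ball hd₁ hd₂
    (K * (R ^ k + 1)) fun z₀ hz₀ => by
      have hz0 : ∀ᶠ z in 𝓝[≠] z₀, z ≠ 0 := by
        rcases eq_or_ne z₀ 0 with rfl | h
        · exact self_mem_nhdsWithin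
        · exact nhdsWithin_le_nhds (isOpen_ne.mem_nhds h)
      filter_upwards [hne' z₀ hz₀, hz0, nhdsWithin_le_nhds (Metric.isOpen_ball.mem_nhds hz₀)]
        with z h1 h2 h3
      exact ⟨h1, hbound z h2 (mem_ball_zero_iff.1 h3) h1⟩
  obtain ⟨b, hb, hbβ⟩ := exists_convergentSeries_of_differentiableOn hβ
  refine ⟨b, hB.ramification_pos, hB.radius_pos, hB.summable, fun w hw => ?_, ?_⟩
  · have hw0 := ne_zero_of_lt_norm_pow hB.ramification_pos hB.radius_pos hw
    exact (summable_branchTerm_iff k b hw0).2 (hb _ ((hwR w hw0).1 hw))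
  rintro _ ⟨w, hw, rfl⟩
  have hw0 := ne_zero_of_lt_norm_pow hB.ramification_pos hB.radius_pos hw
  have hu := (hwR w hw0).1 hw
  have hu0 := inv_ne_zero hw0
  rw [branchValue_eq _ _ hw0, branchValue_eq _ _ hw0, hbβ _ hu]
  have hball : w⁻¹ ∈ Metric.ball (0 : ℂ) R := mem_ball_zero_iff.2 hu
  have hcα : ContinuousAt α w⁻¹ := ((differentiableOn_seriesSum ha).differentiableAt
    (Metric.isOpen_ball.mem_nhds hball)).continuousAt
  have hcβ : ContinuousAt β w⁻¹ :=
    (hβ.differentiableAt (Metric.isOpen_ball.mem_nhds hball)).continuousAt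
  have hcinv : ContinuousAt (fun u : ℂ => u⁻¹ ^ k) w⁻¹ := (continuousAt_inv₀ hu0).pow k
  have hcpt : ContinuousAt (fun u : ℂ => ![u⁻¹ ^ k, u⁻¹ ^ k * α u, u⁻¹ ^ k * β u]) w⁻¹ := by
    refine continuousAt_pi.2 fun i => ?_
    fin_cases i
    · exact hcinv
    · exact hcinv.mul hcα
    · exact hcinv.mul hcβ
  have hclosed : IsClosed (spaceCurve f₁ f₂) :=
    (isClosed_eq (MvPolynomial.continuous_eval f₁) continuous_const).inter
      (isClosed_eq (MvPolynomial.continuous_eval f₂) continuous_const)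
  have := hclosed.mem_of_tendsto (hcpt.tendsto.mono_left (nhdsWithin_le_nhds (s := {w⁻¹}ᶜ))) (by
    filter_upwards [hne' _ hball, nhdsWithin_le_nhds (Metric.isOpen_ball.mem_nhds hball),
      nhdsWithin_le_nhds (isOpen_ne.mem_nhds hu0)] with u h1 h2 h3
    have := hlift' u h3 (mem_ball_zero_iff.1 h2) h1
    rwa [hβeq u h2, mul_div_cancel_right₀ _ h1] at this)
  simpa only [inv_inv] using this

end lift

theorem mainTheorem3
    (f₁ f₂ : MvPolynomial (Fin 3) ℂ) (fp h₁ h₂ : MvPolynomial (Fin 2) ℂ)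
    (hC : IsIrreducibleCurve (spaceCurve f₁ f₂))
    (hinf : ∀ x : Fin 3 → ℂ, IsPointAtInfinity (spaceCurve f₁ f₂) x → x 0 ≠ 0)
    (hfp : fp ≠ 0)
    (hproj : planeCurve fp = zariskiClosure (projectAlongThird '' spaceCurve f₁ f₂))
    (hlift : IsLiftFunction (spaceCurve f₁ f₂) (planeCurve fp) h₁ h₂)
    (k : ℕ) (a : ℕ → ℂ) (M : ℝ)
    (hB : IsPlaneInfinityBranch (planeCurve fp) k a M) :
    ∃ b : ℕ → ℂ,
      -- the corresponding branch of the space curve, and its uniqueness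
      IsSpaceInfinityBranch (spaceCurve f₁ f₂) k a b M ∧
      (∀ (b' : ℕ → ℂ) (M' : ℝ), IsSpaceInfinityBranch (spaceCurve f₁ f₂) k a b' M' → b' = b) ∧
      -- the leading term depends on finitely many coefficients of `r₂` only
      (∃ r : ℕ, LeadingTermDeterminedUpTo (liftPolynomial h₁ h₂) k a r) ∧
      ∀ r : ℕ, LeadingTermDeterminedUpTo (liftPolynomial h₁ h₂) k a r →
        -- every sufficiently long truncation is admissible
        (∀ m : ℕ, ∀ᶠ n in Filter.atTop,
          r + m ≤ n ∧ m + k ≤ expansionDegree (liftPolynomial h₁ h₂) k a n m) ∧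
        ∃ (ρ : MvPolynomial (Fin (r + 1)) ℂ)
          (ρ' : (j : ℕ) → MvPolynomial (Fin (r + j + 1) ⊕ Fin j) ℂ),
          MvPolynomial.eval (fun i : Fin (r + 1) => a i) ρ ≠ 0 ∧
          ∀ m n : ℕ, r + m ≤ n →
            m + k ≤ expansionDegree (liftPolynomial h₁ h₂) k a n m →
            -- shape of the coefficients `Λ_j = b_j ρ - ρ_j`, also after a change of the `aᵢ`, `i > r`
            (∀ a' : ℕ → ℂ, (∀ i ≤ r, a' i = a i) →
              expansionDegree (liftPolynomial h₁ h₂) k a' n m =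
                expansionDegree (liftPolynomial h₁ h₂) k a n m ∧
              ∀ j ≤ m + k,
                expansionCoeff (liftPolynomial h₁ h₂) k a' n m j =
                  MvPolynomial.X j *
                      MvPolynomial.C (MvPolynomial.eval (fun i : Fin (r + 1) => a' i) ρ) -
                    MvPolynomial.aeval
                      (Sum.elim (fun i : Fin (r + j + 1) => MvPolynomial.C (a' i))
                        (fun i : Fin j => (MvPolynomial.X (i : ℕ) : MvPolynomial ℕ ℂ)))
                      (ρ' j)) ∧
            -- the triangular system determines the coefficients `b₀, …, b_{m+k}` of `r₃`
            ∀ c : ℕ → ℂ,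
              (∀ j ≤ m + k,
                MvPolynomial.eval c (expansionCoeff (liftPolynomial h₁ h₂) k a n m j) = 0) ↔
              ∀ j ≤ m + k, c j = b j := by
  have hh₂ : h₂ ≠ 0 := by
    rintro rfl
    obtain ⟨p, -, hp⟩ := hlift.1
    exact hp (map_zero _)
  have hne := branchEval_mk_ne_zero hC hfp hproj hlift hh₂ hB
  obtain ⟨b, hb⟩ := exists_isSpaceInfinityBranch hinf hlift hh₂ hne hB
  have hquot := branchEval_eq_mul_of_isSpaceInfinityBranch hlift hh₂ hne hb
  have hD := totalDegree_right_lt_liftPolynomial h₁ h₂ hh₂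
  refine ⟨b, hb, fun b' M' hb' => ?_, expansion_of_formal_identity b (by omega) hne hquot⟩
  -- Both series satisfy the same formal identity, in which the radius `M'` no longer appears, and
  -- the nonzero factor cancels.
  have hquot' := branchEval_eq_mul_of_isSpaceInfinityBranch hlift hh₂ hne hb'
  have h := mul_right_cancel₀ hne (hquot'.symm.trans hquot)
  funext i
  simpa using congrArg (PowerSeries.coeff i) h
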